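/- Let $L$ be a one-sorted first-order language and $T$ a complete $L$-theory with infinite models. ``Definable'' means definable with parameters. Let $\mathfrak C$ be a monster (large saturated) model of $T$; in fact any $\aleph_0$-saturated model of $T$ may be used. For a complete type $p\in S_1(T)$ let $p(\mathfrak C)$ be the set of its realizations in $\mathfrak C$. A subset of $p(\mathfrak C)$ (a binary relation on $p(\mathfrak C)$) is relatively definable if it is the intersection of $p(\mathfrak C)$ (of $p(\mathfrak C)^2$) with a definable subset of $\mathfrak C$ (of $\mathfrak C^2$), and relatively $\emptyset$-definable if the latter can be chosen definable without parameters. The type $p$ is weakly o-minimal if there is a relatively $\emptyset$-definable linear order $<$ on $p(\mathfrak C)$ such that every relatively definable subset of $p(\mathfrak C)$ has finitely many convex components (maximal convex subsets) in $(p(\mathfrak C),<)$. The theory $T$ is weakly quasi-o-minimal if there is a formula $\theta(x,y)$ without parameters such that in every model $M$ of $T$ the formula $\theta$ defines a (strict) linear order $<$ on $M$, and every definable subset of $M$ is a Boolean combination of $\emptyset$-definable sets and $<$-convex sets. Then $T$ is weakly quasi-o-minimal if and only if every $p\in S_1(T)$ is weakly o-minimal. -/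

import Mathlib

open FirstOrder FirstOrder.Language

universe u v w

namespace WeakOMin

/-! ### Convexity with respect to a strict linear order `lt` on a type `X` -/

/-- `D` is convex in `(X, lt)`. -/
def IsConvexIn {X : Type w} (lt : X → X → Prop) (D : Set X) : Prop :=
  ∀ a ∈ D, ∀ b ∈ D, ∀ c : X, lt a c → lt c b → c ∈ D

/-- `C` is a convex component of `D`: a maximal (for inclusion) convex subset of `D`. -/
def IsConvexComponent {X : Type w} (lt : X → X → Prop) (D C : Set X) : Prop :=
  Maximal (fun C' : Set X => C' ⊆ D ∧ IsConvexIn lt C') C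

/-! ### Saturation, loci, relative definability -/

/-- `M` is `κ`-saturated: for every set `A` of fewer than `κ` parameters, every set of
`L_A`-formulas in one variable that is finitely satisfiable in `M` is realized in `M`. -/
def IsSaturated (L : FirstOrder.Language.{u, v}) (M : Type w) [L.Structure M] (κ : Cardinal.{w}) : Prop :=
  ∀ A : Set M, Cardinal.mk A < κ → ∀ Γ : Set (L[[A]].Formula (Fin 1)),
    (∀ Δ : Set (L[[A]].Formula (Fin 1)), Δ ⊆ Γ → Δ.Finite →
      ∃ a : M, ∀ φ ∈ Δ, φ.Realize (fun _ => a)) →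
    ∃ a : M, ∀ φ ∈ Γ, φ.Realize (fun _ => a)

/-- The locus `p(M)` of a complete 1-type `p ∈ S_1(T)` in a model `M` of `T`. -/
def locus {L : FirstOrder.Language.{u, v}} {T : L.Theory} (p : T.CompleteType (Fin 1))
    (M : Type w) [L.Structure M] [M ⊨ T] [Nonempty M] : Set M :=
  {a : M | T.typeOf (fun _ : Fin 1 => a) = p}

/-- `X ⊆ P` is relatively definable within `P`: it is the trace on `P` of a subset of `M` that is
definable with parameters. -/
def IsRelDefinable (L : FirstOrder.Language.{u, v}) {M : Type w} [L.Structure M] (P : Set M)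
    (X : Set P) : Prop :=
  ∃ D : Set M, (Set.univ : Set M).Definable₁ L D ∧ X = {x : P | (x : M) ∈ D}

/-- The binary relation `r` on `P` is relatively `A`-definable: it is the trace on `P × P` of an
`A`-definable binary relation. -/
def IsRelDefinable₂ (L : FirstOrder.Language.{u, v}) {M : Type w} [L.Structure M] (A : Set M) (P : Set M)
    (r : P → P → Prop) : Prop :=
  ∃ R : Set (M × M), A.Definable₂ L R ∧ ∀ x y : P, r x y ↔ ((x : M), (y : M)) ∈ R

/-! ### Weakly o-minimal orders and types -/

/-- The linear order `(P, lt)` is weakly o-minimal: every relatively definable subset of `P` has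
finitely many convex components. -/
def IsWeaklyOMinimalOrder (L : FirstOrder.Language.{u, v}) {M : Type w} [L.Structure M] (P : Set M)
    (lt : P → P → Prop) : Prop :=
  IsStrictTotalOrder P lt ∧
    ∀ X : Set P, IsRelDefinable L P X → {C : Set P | IsConvexComponent lt X C}.Finite

/-- The type `p ∈ S_1(T)` is weakly o-minimal, where `M` is the ambient (monster) model: some
relatively `∅`-definable linear order on `p(M)` is weakly o-minimal. -/
def IsWeaklyOMinimalType {L : FirstOrder.Language.{u, v}} {T : L.Theory} (p : T.CompleteType (Fin 1))
    (M : Type w) [L.Structure M] [M ⊨ T] [Nonempty M] : Prop :=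
  ∃ lt : locus p M → locus p M → Prop,
    IsRelDefinable₂ L (∅ : Set M) (locus p M) lt ∧ IsWeaklyOMinimalOrder L (locus p M) lt

/-! ### Weakly quasi-o-minimal structures and theories -/

/-- The structure `M` with the linear order `lt` is weakly quasi-o-minimal: every subset of `M`
definable with parameters is a Boolean combination of `∅`-definable sets and `lt`-convex sets. -/
def IsWeaklyQuasiOMinimalStructure (L : FirstOrder.Language.{u, v}) (M : Type w) [L.Structure M]
    (lt : M → M → Prop) : Prop :=
  IsStrictTotalOrder M lt ∧
    ∀ D : Set M, (Set.univ : Set M).Definable₁ L D →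
      D ∈ BooleanSubalgebra.closure
        {X : Set M | (∅ : Set M).Definable₁ L X ∨ IsConvexIn lt X}

/-- The theory `T` is weakly quasi-o-minimal with respect to the order defined by the formula
`θ(x, y)` without parameters: all models of `T` are such. (The universe of the models is at least
that of the language and otherwise arbitrary.) -/
def IsWeaklyQuasiOMinimalWrt {L : FirstOrder.Language.{u, v}} (T : L.Theory) (θ : L.Formula (Fin 2)) : Prop :=
  ∀ (M : Type (max u v w)) [L.Structure M] [M ⊨ T] [Nonempty M],
    IsWeaklyQuasiOMinimalStructure L M (fun a b => θ.Realize ![a, b])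

/-- The theory `T` is weakly quasi-o-minimal with respect to some `∅`-definable linear order. -/
def IsWeaklyQuasiOMinimal {L : FirstOrder.Language.{u, v}} (T : L.Theory) : Prop :=
  ∃ θ : L.Formula (Fin 2), IsWeaklyQuasiOMinimalWrt.{u, v, w} T θ

end WeakOMin

/-! From left to right: an ∅-definable set meets the locus P of a type in nothing or in all of P, so
a Boolean combination of ∅-definable and convex sets traces on P to a Boolean combination of convex
sets, which is a finite union of convex sets.

From right to left the orders witnessing weak o-minimality vary with the type, while one formula
must order every model. By compactness each type contains a formula on which its order is still
linear; finitely many such formulas cover the model, and stacking their orders gives θ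
(`exists_isOrderOn_univ`). The heart of the proof is that θ is as good on each P as the original
order: weak o-minimality does not depend on the order (`FinConv.of_invariant`).

For this let < be weakly o-minimal on P and <' another invariant linear order. Along <, membership
in {y | y <' z} alternates boundedly often, uniformly in z since P is homogeneous. Hence far up in <
all points lie on one <'-side of z; after reversing <' if necessary, they lie above it. Let F(z) be
the largest final segment lying above z in both orders, and identify points with the same F. The
classes are convex for both orders, the orders agree between different classes, and inside a class
the alternation bound drops by one, since the last change of side takes place outside. Induction on
the bound finishes.

Boundedness of alternation can be handled by formulas. Saturation spreads it from P to a formula of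
the type (`exists_formula_not_alt`), completeness carries it to every model, and counting
alternations then writes a definable set, inside each covering formula, as a finite union of convex
sets (`exists_finConv_of_not_alt`). -/

namespace WeakOMin

universe x y

/-! ### Alternating chains -/

/-- There is a `lt`-increasing chain of `n` points of `Q`, none of them below `w`, which are
alternately in and out of `D`, the last one being in `D`. -/
def Alt {X : Type w} (lt : X → X → Prop) (Q D : X → Prop) : ℕ → X → Prop
  | 0, _ => True
  | n + 1, w => ∃ y, ¬ lt y w ∧ Q y ∧ (D y ↔ Even n) ∧ Alt lt Q D n y

section Alt

variable {X : Type w} {lt : X → X → Prop} {Q Q' D D' : X → Prop}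

theorem Alt.mono {n : ℕ} {w : X} (hQ : ∀ y, Q y → Q' y) (hD : ∀ y, Q y → (D y ↔ D' y))
    (h : Alt lt Q D n w) : Alt lt Q' D' n w := by
  induction n generalizing w with
  | zero => trivial
  | succ n ih =>
    obtain ⟨y, hy, hq, hd, h⟩ := h
    exact ⟨y, hy, hQ y hq, (hD y hq).symm.trans hd, ih h⟩

variable [IsStrictTotalOrder X lt]

theorem not_lt_trans {a b c : X} (hab : ¬ lt b a) (hbc : ¬ lt c b) : ¬ lt c a := by
  intro hca
  rcases trichotomous_of lt a b with h | rfl | h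
  · exact hbc (trans_of lt hca h)
  · exact hbc hca
  · exact hab h

theorem lt_of_lt_of_not_lt {a b c : X} (hab : lt a b) (hbc : ¬ lt c b) : lt a c := by
  rcases trichotomous_of lt b c with h | rfl | h
  · exact trans_of lt hab h
  · exact hab
  · exact absurd h hbc

theorem lt_of_not_lt_of_lt {a b c : X} (hab : ¬ lt b a) (hbc : lt b c) : lt a c := by
  rcases trichotomous_of lt a b with h | rfl | h
  · exact trans_of lt h hbc
  · exact hbc
  · exact absurd h hab

theorem lt_of_not_lt_of_ne {a b : X} (h : ¬ lt b a) (hne : a ≠ b) : lt a b :=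
  ((trichotomous_of lt a b).resolve_right (by rintro (h' | h') <;> contradiction))

theorem Alt.of_not_lt {n : ℕ} {w w' : X} (h : Alt lt Q D n w) (hw : ¬ lt w w') :
    Alt lt Q D n w' := by
  cases n with
  | zero => trivial
  | succ n =>
    obtain ⟨y, hy, h⟩ := h
    exact ⟨y, not_lt_trans hw hy, h⟩

theorem Alt.of_succ {n : ℕ} {w : X} (h : Alt lt Q D (n + 1) w) : Alt lt Q D n w := by
  obtain ⟨y, hy, -, -, h⟩ := h
  exact h.of_not_lt hy

theorem Alt.of_le {m n : ℕ} (hmn : m ≤ n) {w : X} (h : Alt lt Q D n w) : Alt lt Q D m w := by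
  induction hmn with
  | refl => exact h
  | step _ ih => exact ih h.of_succ

end Alt

/-! ### Finite unions of convex sets -/

/-- `D` is a finite union of convex subsets of `(X, lt)`. -/
def FinConv {X : Type w} (lt : X → X → Prop) (D : Set X) : Prop :=
  ∃ 𝒞 : Set (Set X), 𝒞.Finite ∧ (∀ C ∈ 𝒞, IsConvexIn lt C) ∧ ⋃₀ 𝒞 = D

section FinConv

variable {X : Type w} {lt : X → X → Prop}

theorem IsConvexIn.finConv {D : Set X} (h : IsConvexIn lt D) : FinConv lt D :=
  ⟨{D}, Set.finite_singleton D, by simpa using h, Set.sUnion_singleton D⟩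

theorem isConvexIn_empty : IsConvexIn lt (∅ : Set X) := fun _ h => h.elim

theorem isConvexIn_univ : IsConvexIn lt (Set.univ : Set X) := fun _ _ _ _ _ _ _ => trivial

theorem IsConvexIn.inter {C D : Set X} (hC : IsConvexIn lt C) (hD : IsConvexIn lt D) :
    IsConvexIn lt (C ∩ D) := fun a ha b hb c hac hcb =>
  ⟨hC a ha.1 b hb.1 c hac hcb, hD a ha.2 b hb.2 c hac hcb⟩

theorem FinConv.union {C D : Set X} (hC : FinConv lt C) (hD : FinConv lt D) :
    FinConv lt (C ∪ D) := by
  obtain ⟨𝒞, hf, hc, rfl⟩ := hC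
  obtain ⟨𝒟, hf', hc', rfl⟩ := hD
  refine ⟨𝒞 ∪ 𝒟, hf.union hf', ?_, Set.sUnion_union 𝒞 𝒟⟩
  rintro C (h | h)
  exacts [hc C h, hc' C h]

theorem FinConv.inter {C D : Set X} (hC : FinConv lt C) (hD : FinConv lt D) :
    FinConv lt (C ∩ D) := by
  obtain ⟨𝒞, hf, hc, rfl⟩ := hC
  obtain ⟨𝒟, hf', hc', rfl⟩ := hD
  refine ⟨Set.image2 (· ∩ ·) 𝒞 𝒟, hf.image2 _ hf', ?_, ?_⟩
  · rintro _ ⟨C, hC, D, hD, rfl⟩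
    exact (hc C hC).inter (hc' D hD)
  · ext x
    simp only [Set.sUnion_image2, Set.mem_iUnion, Set.mem_inter_iff, Set.mem_sUnion]
    grind

theorem FinConv.sUnion {𝒞 : Set (Set X)} (hf : 𝒞.Finite) (h : ∀ C ∈ 𝒞, FinConv lt C) :
    FinConv lt (⋃₀ 𝒞) := by
  induction 𝒞, hf using Set.Finite.induction_on with
  | empty => simpa using isConvexIn_empty.finConv
  | insert _ _ ih =>
    rw [Set.sUnion_insert]
    exact (h _ (Set.mem_insert _ _)).union (ih fun C hC => h C (Set.mem_insert_of_mem _ hC))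

theorem FinConv.sInter {𝒞 : Set (Set X)} (hf : 𝒞.Finite) (h : ∀ C ∈ 𝒞, FinConv lt C) :
    FinConv lt (⋂₀ 𝒞) := by
  induction 𝒞, hf using Set.Finite.induction_on with
  | empty => simpa using isConvexIn_univ.finConv
  | insert _ _ ih =>
    rw [Set.sInter_insert]
    exact (h _ (Set.mem_insert _ _)).inter (ih fun C hC => h C (Set.mem_insert_of_mem _ hC))

variable [IsStrictTotalOrder X lt]

theorem IsConvexIn.finConv_compl {D : Set X} (h : IsConvexIn lt D) : FinConv lt Dᶜ := by
  by_cases hD : D = ∅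
  · rw [hD, Set.compl_empty]
    exact isConvexIn_univ.finConv
  obtain ⟨d, hd⟩ := Set.nonempty_iff_ne_empty.2 hD
  have h₁ : IsConvexIn lt {x | x ∉ D ∧ lt x d} := fun a ha b hb c hac hcb =>
    ⟨fun hc => hb.1 (h c hc d hd b hcb hb.2), trans_of lt hcb hb.2⟩
  have h₂ : IsConvexIn lt {x | x ∉ D ∧ lt d x} := fun a ha b hb c hac hcb =>
    ⟨fun hc => ha.1 (h d hd c hc a ha.2 hac), trans_of lt ha.2 hac⟩
  have := h₁.finConv.union h₂.finConv
  convert this using 1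
  ext x
  have := trichotomous_of lt x d
  simp only [Set.mem_compl_iff, Set.mem_union, Set.mem_ofPred_eq]
  grind

theorem FinConv.compl {D : Set X} (h : FinConv lt D) : FinConv lt Dᶜ := by
  obtain ⟨𝒞, hf, hc, rfl⟩ := h
  rw [Set.compl_sUnion]
  refine FinConv.sInter (hf.image _) ?_
  rintro _ ⟨C, hC, rfl⟩
  exact (hc C hC).finConv_compl

/-- The family of finite unions of convex sets. -/
def finConvSubalgebra (X : Type w) (lt : X → X → Prop) [IsStrictTotalOrder X lt] :
    BooleanSubalgebra (Set X) where
  carrier := {D | FinConv lt D}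
  supClosed' _ hC _ hD := hC.union hD
  infClosed' _ hC _ hD := hC.inter hD
  compl_mem' h := h.compl
  bot_mem' := isConvexIn_empty.finConv

theorem FinConv.exists_not_alt {D : Set X} (h : FinConv lt D) (Q : X → Prop) :
    ∃ N, ∀ w, ¬ Alt lt Q (· ∈ D) N w := by
  obtain ⟨𝒞, hf, hc, rfl⟩ := h
  -- A convex member through a point y of the chain cannot pass the later point z outside D, so each
  -- return to D uses up a member of the family.
  have key : ∀ k w, Alt lt Q (· ∈ ⋃₀ 𝒞) (2 * k + 1) w →
      k + 1 ≤ {C ∈ 𝒞 | ∃ c ∈ C, ¬ lt c w}.ncard := by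
    intro k
    induction k with
    | zero =>
      rintro w ⟨y, hy, -, hd, -⟩
      obtain ⟨C, hC, hyC⟩ := hd.2 (by simp)
      have : ({C ∈ 𝒞 | ∃ c ∈ C, ¬ lt c w}).Nonempty := ⟨C, hC, y, hyC, hy⟩
      exact (Set.ncard_pos (hf.subset (Set.sep_subset _ _))).2 this
    | succ k ih =>
      rintro w ⟨y, hy, -, hd, z, hz, -, hd', h⟩
      obtain ⟨C, hC, hyC⟩ := hd.2 (by grind)
      have hzD : z ∉ ⋃₀ 𝒞 := fun h => by
        have := hd'.1 h
        grind
      have hyz : y ≠ z := by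
        rintro rfl
        exact hzD ⟨C, hC, hyC⟩
      have hlt := lt_of_not_lt_of_ne hz hyz
      refine (Nat.succ_le_succ (ih z h)).trans ?_
      refine Set.ncard_lt_ncard ?_ (hf.subset (Set.sep_subset _ _))
      refine ⟨fun B hB => ⟨hB.1, ?_⟩, fun hsub => ?_⟩
      · obtain ⟨c, hcB, hcz⟩ := hB.2
        exact ⟨c, hcB, not_lt_trans hy (not_lt_trans hz hcz)⟩
      · obtain ⟨-, c, hcC, hcz⟩ := hsub ⟨hC, y, hyC, hy⟩
        refine hzD ⟨C, hC, ?_⟩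
        by_cases hcz' : z = c
        · exact hcz' ▸ hcC
        · exact hc C hC y hyC c hcC z hlt (lt_of_not_lt_of_ne hcz hcz')
  refine ⟨2 * 𝒞.ncard + 1, fun w h => ?_⟩
  have := (key _ w h).trans (Set.ncard_le_ncard (Set.sep_subset _ _) hf)
  omega

/-- If alternating chains are bounded, a trace on `Q` is the trace of finitely many convex sets. -/
theorem exists_finConv_of_not_alt {Q D : Set X} {N : ℕ}
    (h : ∀ w, ¬ Alt lt (· ∈ Q) (· ∈ D) N w) :
    ∃ F, FinConv lt F ∧ Q ∩ D = Q ∩ F := by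
  classical
  -- The sets U n are decreasing initial segments. A point of Q in U n but not in U (n + 1) has the
  -- wrong parity to be prepended to a chain of length n, so it is in D exactly when n is odd.
  let U : ℕ → Set X := fun n => {w | Alt lt (· ∈ Q) (· ∈ D) n w}
  have hU : ∀ n, IsConvexIn lt (U n) := fun n a _ b hb c _ hcb =>
    Alt.of_not_lt hb fun hbc => irrefl_of lt c (trans_of lt hcb hbc)
  let lev : ℕ → Set X := fun n => U n \ U (n + 1)
  have hlev : ∀ n, FinConv lt (lev n) := fun n =>
    (hU n).finConv.inter (hU (n + 1)).finConv_compl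
  refine ⟨⋃₀ (lev '' {n | n < N ∧ ¬ Even n}),
    FinConv.sUnion (((Set.finite_lt_nat N).subset fun _ h => h.1).image _) ?_, ?_⟩
  · rintro _ ⟨n, -, rfl⟩
    exact hlev n
  · ext y
    simp only [Set.mem_inter_iff, and_congr_right_iff]
    intro hyQ
    have hex : ∃ n, ¬ Alt lt (· ∈ Q) (· ∈ D) n y := ⟨N, h y⟩
    obtain ⟨k, hk⟩ : ∃ k, Nat.find hex = k + 1 := by
      refine Nat.exists_eq_succ_of_ne_zero fun h0 => ?_
      exact h0 ▸ Nat.find_spec hex <| trivial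
    have hk1 : ¬ Alt lt (· ∈ Q) (· ∈ D) (k + 1) y := hk ▸ Nat.find_spec hex
    have hk0 : Alt lt (· ∈ Q) (· ∈ D) k y :=
      not_not.1 (Nat.find_min hex (show k < Nat.find hex by omega))
    have hpar : ¬ (y ∈ D ↔ Even k) := fun he =>
      hk1 ⟨y, irrefl_of lt y, hyQ, he, hk0⟩
    have huniq : ∀ n, y ∈ lev n → n = k := by
      rintro n ⟨h0, h1⟩
      rcases lt_trichotomy n k with hn | hn | hn
      · exact (h1 (Alt.of_le hn hk0)).elim
      · exact hn
      · exact (hk1 (Alt.of_le hn h0)).elim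
    have hkN : k < N := by
      by_contra hkN
      exact h y (Alt.of_le (not_lt.1 hkN) hk0)
    constructor
    · intro hyD
      exact ⟨_, ⟨k, ⟨hkN, fun he => hpar (iff_of_true hyD he)⟩, rfl⟩, hk0, hk1⟩
    · rintro ⟨_, ⟨n, ⟨-, hn⟩, rfl⟩, hy⟩
      rw [huniq n hy] at hn
      by_contra hyD
      exact hpar (iff_of_false hyD hn)

/-- The maximal convex subset of `D` around `x`. -/
def component (lt : X → X → Prop) (D : Set X) (x : X) : Set X :=
  {y ∈ D | ∀ z, (lt x z → lt z y → z ∈ D) ∧ (lt y z → lt z x → z ∈ D)}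

theorem isConvexComponent_component {D : Set X} {x : X} (hx : x ∈ D) :
    IsConvexComponent lt D (component lt D x) := by
  refine ⟨⟨Set.sep_subset _ _, ?_⟩, ?_⟩
  · have ht : ∀ a b c, lt a b → lt b c → lt a c := fun _ _ _ => trans_of lt
    have htri := trichotomous_of lt
    have hirr := irrefl_of lt
    intro a ha b hb c hac hcb
    obtain ⟨haD, ha⟩ := ha
    obtain ⟨hbD, hb⟩ := hb
    refine ⟨?_, fun z => ⟨fun h1 h2 => (hb z).1 h1 (ht _ _ _ h2 hcb),
      fun h1 h2 => (ha z).2 (ht _ _ _ hac h1) h2⟩⟩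
    rcases htri x c with h | rfl | h
    · exact (hb c).1 h hcb
    · exact hx
    · exact (ha c).2 hac h
  · rintro C ⟨hCD, hC⟩ hsub y hy
    have hxC : x ∈ C := hsub ⟨hx, fun z =>
      ⟨fun h1 h2 => (irrefl_of lt x (trans_of lt h1 h2)).elim,
        fun h1 h2 => (irrefl_of lt x (trans_of lt h1 h2)).elim⟩⟩
    exact ⟨hCD hy, fun z => ⟨fun h1 h2 => hCD (hC x hxC y hy z h1 h2),
      fun h1 h2 => hCD (hC y hy x hxC z h1 h2)⟩⟩

theorem mem_component {D : Set X} {x : X} (hx : x ∈ D) : x ∈ component lt D x :=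
  ⟨hx, fun _ => ⟨fun h1 h2 => (irrefl_of lt x (trans_of lt h1 h2)).elim,
    fun h1 h2 => (irrefl_of lt x (trans_of lt h1 h2)).elim⟩⟩

theorem IsConvexComponent.eq_component {D C : Set X} (hC : IsConvexComponent lt D C) {x : X}
    (hx : x ∈ C) : C = component lt D x := by
  refine subset_antisymm ?_ ?_
  · intro y hy
    exact ⟨hC.1.1 hy, fun z => ⟨fun h1 h2 => hC.1.1 (hC.1.2 x hx y hy z h1 h2),
      fun h1 h2 => hC.1.1 (hC.1.2 y hy x hx z h1 h2)⟩⟩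
  · refine hC.2 (isConvexComponent_component (hC.1.1 hx)).1 ?_
    intro y hy
    exact ⟨hC.1.1 hy, fun z => ⟨fun h1 h2 => hC.1.1 (hC.1.2 x hx y hy z h1 h2),
      fun h1 h2 => hC.1.1 (hC.1.2 y hy x hx z h1 h2)⟩⟩

theorem finite_isConvexComponent_iff {D : Set X} :
    {C | IsConvexComponent lt D C}.Finite ↔ FinConv lt D := by
  constructor
  · intro h
    refine ⟨_, h, fun C hC => hC.1.2, subset_antisymm ?_ ?_⟩
    · rintro x ⟨C, hC, hx⟩
      exact hC.1.1 hx
    · intro x hx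
      exact ⟨_, isConvexComponent_component hx, mem_component hx⟩
  · rintro ⟨𝒞, hf, hc, rfl⟩
    -- Each nonempty component is the one around some member of 𝒞. The empty set is added because it
    -- is itself a component when D is empty.
    refine ((hf.image fun B => ⋃ x ∈ B, component lt (⋃₀ 𝒞) x).insert ∅).subset ?_
    intro C hC
    rcases C.eq_empty_or_nonempty with rfl | ⟨x, hx⟩
    · exact Set.mem_insert _ _
    obtain ⟨B, hB, hxB⟩ := hC.1.1 hx
    refine Set.mem_insert_of_mem _ ⟨B, hB, ?_⟩
    have hBx : B ⊆ component lt (⋃₀ 𝒞) x := fun y hy => ⟨⟨B, hB, hy⟩, fun z =>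
      ⟨fun h1 h2 => ⟨B, hB, hc B hB x hxB y hy z h1 h2⟩,
        fun h1 h2 => ⟨B, hB, hc B hB y hy x hxB z h1 h2⟩⟩⟩
    have hCx := hC.eq_component hx
    refine subset_antisymm ?_ ?_
    · simp only [Set.iUnion_subset_iff]
      intro y hy
      rw [← hC.eq_component (x := y) (by rw [hCx]; exact hBx hy)]
    · intro y hy
      simp only [Set.mem_iUnion]
      exact ⟨x, hxB, by rwa [← hCx]⟩

end FinConv

/-! ### Back-and-forth systems -/

/-- `I` is a back-and-forth system on `X`, consisting of (graphs of) partial maps and acting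
transitively on points. -/
structure IsBackAndForth {X : Type w} (I : Set (X × X) → Prop) : Prop where
  single : ∀ a b, I {(a, b)}
  forth : ∀ S, I S → ∀ a, ∃ b, I (insert (a, b) S)
  back : ∀ S, I S → ∀ b, ∃ a, I (insert (a, b) S)

/-- The binary relation `r` is preserved by all members of `I`. -/
def IsInvariant {X : Type w} (I : Set (X × X) → Prop) (r : X → X → Prop) : Prop :=
  ∀ S, I S → ∀ a a' b b', (a, a') ∈ S → (b, b') ∈ S → (r a b ↔ r a' b')

/-- `E` is an `I`-invariant equivalence relation whose classes are convex for two orders. -/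
structure IsBiconvex {X : Type w} (I : Set (X × X) → Prop) (lt lt' E : X → X → Prop) :
    Prop where
  equiv : Equivalence E
  invariant : IsInvariant I E
  left : ∀ a c b, lt a c → lt c b → E a b → E a c
  right : ∀ a c b, lt' a c → lt' c b → E a b → E a c

/-- `x` lies in the largest final segment of the class of `a` that is above `a` in both
orders. -/
def FinalSeg {X : Type w} (lt lt' E : X → X → Prop) (a x : X) : Prop :=
  E a x ∧ lt a x ∧ ∀ y, E a y → ¬ lt y x → lt' a y

/-- Points of an `E`-class with the same final segment. -/
def Refine {X : Type w} (lt lt' E : X → X → Prop) (a b : X) : Prop :=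
  E a b ∧ ∀ x, FinalSeg lt lt' E a x ↔ FinalSeg lt lt' E b x

/-! ### Relations invariant under a back-and-forth system -/

section

variable {X : Type w} {I : Set (X × X) → Prop} {lt lt' E : X → X → Prop}

theorem IsInvariant.flip {r : X → X → Prop} (h : IsInvariant I r) :
    IsInvariant I fun a b => r b a :=
  fun S hS a a' b b' ha hb => h S hS b b' a a' hb ha

theorem IsBiconvex.swap (h : IsBiconvex I lt lt' E) : IsBiconvex I lt (fun a b => lt' b a) E where
  equiv := h.equiv
  invariant := h.invariant
  left := h.left
  right a c b hac hcb hab := h.equiv.trans hab (h.right b c a hcb hac (h.equiv.symm hab))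

/-- The quantifier in `FinalSeg` ranges over the locus only, so the relation need not be relatively
definable; back-and-forth moves the quantified point instead. -/
theorem IsInvariant.finalSeg (hI : IsBackAndForth I) (hlt : IsInvariant I lt)
    (hlt' : IsInvariant I lt') (hE : IsInvariant I E) :
    IsInvariant I (FinalSeg lt lt' E) := by
  intro S hS a a' b b' ha hb
  unfold FinalSeg
  rw [hE S hS a a' b b' ha hb, hlt S hS a a' b b' ha hb]
  refine and_congr_right fun _ => and_congr_right fun _ => ⟨fun h y' => ?_, fun h y => ?_⟩
  · obtain ⟨y, hy⟩ := hI.back S hS y'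
    have h1 : (y, y') ∈ insert (y, y') S := Set.mem_insert _ _
    have h2 := Set.mem_insert_of_mem (y, y') ha
    have h3 := Set.mem_insert_of_mem (y, y') hb
    rw [← hE _ hy a a' y y' h2 h1, ← hlt _ hy y y' b b' h1 h3, ← hlt' _ hy a a' y y' h2 h1]
    exact h y
  · obtain ⟨y', hy⟩ := hI.forth S hS y
    have h1 : (y, y') ∈ insert (y, y') S := Set.mem_insert _ _
    have h2 := Set.mem_insert_of_mem (y, y') ha
    have h3 := Set.mem_insert_of_mem (y, y') hb
    rw [hE _ hy a a' y y' h2 h1, hlt _ hy y y' b b' h1 h3, hlt' _ hy a a' y y' h2 h1]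
    exact h y'

theorem IsInvariant.refine (hI : IsBackAndForth I) (hlt : IsInvariant I lt)
    (hlt' : IsInvariant I lt') (hE : IsInvariant I E) :
    IsInvariant I (Refine lt lt' E) := by
  have hF := IsInvariant.finalSeg hI hlt hlt' hE
  intro S hS a a' b b' ha hb
  unfold Refine
  rw [hE S hS a a' b b' ha hb]
  refine and_congr_right fun _ => ⟨fun h y' => ?_, fun h y => ?_⟩
  · obtain ⟨y, hy⟩ := hI.back S hS y'
    have h1 : (y, y') ∈ insert (y, y') S := Set.mem_insert _ _
    have h2 := Set.mem_insert_of_mem (y, y') ha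
    have h3 := Set.mem_insert_of_mem (y, y') hb
    rw [← hF _ hy a a' y y' h2 h1, ← hF _ hy b b' y y' h3 h1]
    exact h y
  · obtain ⟨y', hy⟩ := hI.forth S hS y
    have h1 : (y, y') ∈ insert (y, y') S := Set.mem_insert _ _
    have h2 := Set.mem_insert_of_mem (y, y') ha
    have h3 := Set.mem_insert_of_mem (y, y') hb
    rw [hF _ hy a a' y y' h2 h1, hF _ hy b b' y y' h3 h1]
    exact h y'

theorem IsInvariant.alt (hI : IsBackAndForth I) (hlt : IsInvariant I lt)
    (hlt' : IsInvariant I lt') {S : Set (X × X)} (hS : I S) {z z' w w' : X} (hz : (z, z') ∈ S)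
    (hw : (w, w') ∈ S) {n : ℕ} (h : Alt lt (fun _ => True) (fun y => lt' y z) n w) :
    Alt lt (fun _ => True) (fun y => lt' y z') n w' := by
  induction n generalizing S w w' with
  | zero => trivial
  | succ n ih =>
    obtain ⟨y, hyw, -, hyz, h⟩ := h
    obtain ⟨y', hy⟩ := hI.forth S hS y
    have h1 : (y, y') ∈ insert (y, y') S := Set.mem_insert _ _
    have h2 := Set.mem_insert_of_mem (y, y') hz
    have h3 := Set.mem_insert_of_mem (y, y') hw
    refine ⟨y', ?_, trivial, ?_, ih hy h2 h1 h⟩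
    · rwa [← hlt _ hy y y' w w' h1 h3]
    · exact (hlt' _ hy y y' z z' h1 h2).symm.trans hyz

/-- A bound for one z₀ serves all z, because a chain for z can be carried to a chain for z₀. -/
theorem exists_forall_not_alt [IsStrictTotalOrder X lt] (hI : IsBackAndForth I)
    (hlt : IsInvariant I lt) (hlt' : IsInvariant I lt')
    (hfin : ∀ z, FinConv lt {y | lt' y z}) :
    ∃ N, ∀ z w, ¬ Alt lt (fun _ => True) (fun y => lt' y z) N w := by
  by_cases hX : Nonempty X
  · obtain ⟨z₀⟩ := hX
    obtain ⟨N, hN⟩ := (hfin z₀).exists_not_alt fun _ => True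
    refine ⟨N, fun z w h => ?_⟩
    obtain ⟨w', hw'⟩ := hI.forth _ (hI.single z z₀) w
    exact hN w' (IsInvariant.alt hI hlt hlt' hw' (z := z) (w := w) (by simp) (by simp) h)
  · exact ⟨0, fun z => (hX ⟨z⟩).elim⟩

end

/-! ### Final segments and the refined equivalence relation -/

section Order

variable {X : Type w} {I : Set (X × X) → Prop} {lt lt' E : X → X → Prop}
  [IsStrictTotalOrder X lt]

theorem FinalSeg.of_not_lt {a x y : X} (h : FinalSeg lt lt' E a x) (hxy : ¬ lt y x)
    (hy : E a y) : FinalSeg lt lt' E a y :=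
  ⟨hy, lt_of_lt_of_not_lt h.2.1 hxy, fun z hz hzy => h.2.2 z hz (not_lt_trans hxy hzy)⟩

theorem not_finalSeg_self {a : X} : ¬ FinalSeg lt lt' E a a := fun h => irrefl_of lt a h.2.1

variable [IsStrictTotalOrder X lt']

/-- A point `b` with `a < b` and `b <' a` has a final segment contained in that of `a`. -/
theorem not_finalSeg_of_lt_of_lt (hI : IsBackAndForth I) (hlt : IsInvariant I lt)
    (hlt' : IsInvariant I lt') (hE : IsBiconvex I lt lt' E) {N : ℕ}
    (hN : ∀ z w, ¬ Alt lt (fun _ => True) (fun y => lt' y z) N w) {a b x : X}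
    (hab : lt a b) (hxa' : lt' x a) (hEab : E a b) :
    ¬ FinalSeg lt lt' E b x := by
  intro hF
  have hFi := IsInvariant.finalSeg hI hlt hlt' hE.invariant
  -- By homogeneity a bad configuration at a reappears at every point, so it can be iterated.
  have hall : ∀ c, ∃ d y, lt c d ∧ lt' y c ∧ E c d ∧ FinalSeg lt lt' E d y := by
    intro c
    obtain ⟨d, hd⟩ := hI.forth {(a, c)} (hI.single a c) b
    obtain ⟨y, hy⟩ := hI.forth _ hd x
    have ha : (a, c) ∈ (insert (x, y) (insert (b, d) {(a, c)}) : Set (X × X)) := by simp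
    have hb : (b, d) ∈ (insert (x, y) (insert (b, d) {(a, c)}) : Set (X × X)) := by simp
    have hx : (x, y) ∈ (insert (x, y) (insert (b, d) {(a, c)}) : Set (X × X)) := by simp
    exact ⟨d, y, (hlt _ hy _ _ _ _ ha hb).1 hab, (hlt' _ hy _ _ _ _ hx ha).1 hxa',
      (hE.invariant _ hy _ _ _ _ ha hb).1 hEab, (hFi _ hy _ _ _ _ hb hx).1 hF⟩
  -- Apply the induction hypothesis at x to get z. Then b <' z <' a, so a and b, prepended to the
  -- chain starting from x, add two alternations around z.
  have key : ∀ k a, ∃ z, ¬ lt z a ∧ ¬ lt' a z ∧ E a z ∧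
      Alt lt (fun _ => True) (fun y => lt' y z) (2 * k) a := by
    intro k
    induction k with
    | zero => exact fun a => ⟨a, irrefl_of lt a, irrefl_of lt' a, hE.equiv.refl a, trivial⟩
    | succ k ih =>
      intro a
      obtain ⟨b, x, hab, hxa, hEab, hF⟩ := hall a
      obtain ⟨z, hzx, hxz, hExz, halt⟩ := ih x
      have hax : lt a x := trans_of lt hab hF.2.1
      have haz : lt a z := lt_of_lt_of_not_lt hax hzx
      have hza : lt' z a := lt_of_not_lt_of_lt hxz hxa
      have hbz : lt' b z := hF.2.2 z (hE.equiv.trans hF.1 hExz) hzx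
      refine ⟨z, asymm_of lt haz, asymm_of lt' hza,
        hE.equiv.trans hEab (hE.equiv.trans hF.1 hExz), a, irrefl_of lt a, trivial,
        iff_of_false (asymm_of lt' hza) (by grind), b, asymm_of lt hab, trivial,
        iff_of_true hbz (by grind), halt.of_not_lt (asymm_of lt hF.2.1)⟩
  obtain ⟨z, -, -, -, h⟩ := key N a
  exact hN z a (Alt.of_le (by omega) h)

/-- Points beyond x lie above b, hence above a, in <'. The point a cannot itself lie beyond x, since
it would then be above b. -/
theorem FinalSeg.anti (hE : Equivalence E) {a b x : X} (hab : lt' a b) (hEab : E a b)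
    (h : FinalSeg lt lt' E b x) : FinalSeg lt lt' E a x := by
  refine ⟨hE.trans hEab h.1, lt_of_not_lt_of_ne ?_ ?_, fun y hy hyx =>
    trans_of lt' hab (h.2.2 y (hE.trans (hE.symm hEab) hy) hyx)⟩
  · intro hxa
    exact asymm_of lt' hab (h.2.2 a (hE.symm hEab) (asymm_of lt hxa))
  · rintro rfl
    exact asymm_of lt' hab (h.2.2 a (hE.symm hEab) (irrefl_of lt a))

section Refine

variable (hI : IsBackAndForth I) (hlt : IsInvariant I lt) (hlt' : IsInvariant I lt')
  (hE : IsBiconvex I lt lt' E) {N : ℕ}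
  (hN : ∀ z w, ¬ Alt lt (fun _ => True) (fun y => lt' y z) N w)

include hI hlt hlt' hE hN

/-- Final segments thus shrink along < as well as along <'. The bound on alternations is needed only
for <. -/
theorem FinalSeg.of_lt {a c x : X} (hac : lt a c) (hEac : E a c)
    (h : FinalSeg lt lt' E c x) : FinalSeg lt lt' E a x := by
  refine ⟨hE.equiv.trans hEac h.1, trans_of lt hac h.2.1, fun y hy hyx => ?_⟩
  by_contra hay
  have hcy := h.of_not_lt hyx (hE.equiv.trans (hE.equiv.symm hEac) hy)
  refine not_finalSeg_of_lt_of_lt hI hlt hlt' hE hN hac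
    (lt_of_not_lt_of_ne hay ?_) hEac hcy
  rintro rfl
  exact asymm_of lt hac hcy.2.1

/-- Some w ≥ c satisfies w <' a. Then F(a) ⊆ F(w) by `FinalSeg.anti` and F(w) ⊆ F(c) ⊆ F(a) by
`FinalSeg.of_lt`. -/
theorem refine_of_lt_of_not_finalSeg {a c : X} (hac : lt a c) (hEac : E a c)
    (h : ¬ FinalSeg lt lt' E a c) : Refine lt lt' E a c := by
  refine ⟨hEac, fun x => ⟨fun hx => ?_, FinalSeg.of_lt hI hlt hlt' hE hN hac hEac⟩⟩
  have hEca := hE.equiv.symm hEac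
  obtain ⟨w, hw, hwc, haw⟩ : ∃ w, E a w ∧ ¬ lt w c ∧ ¬ lt' a w := by
    by_contra! hcon
    exact h ⟨hEac, hac, hcon⟩
  have hwa : lt' w a := by
    refine lt_of_not_lt_of_ne haw ?_
    rintro rfl
    exact hwc hac
  have hwx : lt w x := by
    by_contra hwx
    exact haw (hx.2.2 w hw hwx)
  refine ⟨hE.equiv.trans hEca hx.1, lt_of_not_lt_of_lt hwc hwx, fun y hy hyx => ?_⟩
  by_contra hcy
  have hcx : lt c x := lt_of_not_lt_of_lt hwc hwx
  have hyc : lt' y c := by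
    refine lt_of_not_lt_of_ne hcy ?_
    rintro rfl
    exact hyx hcx
  have hay : lt' a y := hx.2.2 y (hE.equiv.trans hEac hy) hyx
  have hac' : lt' a c := trans_of lt' hay hyc
  have hcw : lt c w := by
    refine lt_of_not_lt_of_ne hwc ?_
    rintro rfl
    exact haw hac'
  have hFw : FinalSeg lt lt' E w x := hx.anti hE.equiv hwa (hE.equiv.symm hw)
  have hFc := FinalSeg.of_lt hI hlt hlt' hE hN hcw (hE.equiv.trans hEca hw) hFw
  exact hcy (hFc.2.2 y hy hyx)

/-- For a < c < b with F(a) = F(b), having c in F(a) would put b in F(b). For <', monotonicity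
squeezes F(c) between F(a) and F(b). -/
theorem IsBiconvex.refine : IsBiconvex I lt lt' (Refine lt lt' E) where
  equiv :=
    ⟨fun a => ⟨hE.equiv.refl a, fun _ => Iff.rfl⟩,
      fun h => ⟨hE.equiv.symm h.1, fun x => (h.2 x).symm⟩,
      fun h h' => ⟨hE.equiv.trans h.1 h'.1, fun x => (h.2 x).trans (h'.2 x)⟩⟩
  invariant := IsInvariant.refine hI hlt hlt' hE.invariant
  left a c b hac hcb hab := by
    refine refine_of_lt_of_not_finalSeg hI hlt hlt' hE hN hac (hE.left a c b hac hcb hab.1) ?_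
    intro h
    exact not_finalSeg_self ((hab.2 b).1 (h.of_not_lt (asymm_of lt hcb) hab.1))
  right a c b hac hcb hab := by
    have hEac := hE.right a c b hac hcb hab.1
    refine ⟨hEac, fun x => ⟨fun h => ?_, FinalSeg.anti hE.equiv hac hEac⟩⟩
    exact ((hab.2 x).1 h).anti hE.equiv hcb (hE.equiv.trans (hE.equiv.symm hEac) hab.1)

/-- If a < c are not identified then c lies in F(a), so a <' c. -/
theorem lt_iff_lt_of_not_refine {a c : X} (hEac : E a c) (h : ¬ Refine lt lt' E a c) :
    lt a c ↔ lt' a c := by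
  have hR := hE.refine hI hlt hlt' hN
  have key : ∀ a c, E a c → ¬ Refine lt lt' E a c → lt a c → lt' a c := by
    intro a c hEac h hac
    by_contra hcon
    refine h (refine_of_lt_of_not_finalSeg hI hlt hlt' hE hN hac hEac fun hF => ?_)
    exact hcon (hF.2.2 c hEac (irrefl_of lt c))
  refine ⟨key a c hEac h, fun hac => ?_⟩
  by_contra hcon
  have hne : c ≠ a := by
    rintro rfl
    exact irrefl_of lt' c hac
  exact asymm_of lt' hac (key c a (hE.equiv.symm hEac) (fun h' => h (hR.equiv.symm h'))
    (lt_of_not_lt_of_ne hcon hne))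

/-- Passing from the refined relation back to `E`. -/
theorem finConv_of_refine
    (hfin : ∀ (C : Set X), IsConvexIn lt C → (∀ x ∈ C, ∀ y ∈ C, Refine lt lt' E x y) →
      FinConv lt' C) {C : Set X} (hC : IsConvexIn lt C) (hCE : ∀ x ∈ C, ∀ y ∈ C, E x y) :
    FinConv lt' C := by
  have hR := hE.refine hI hlt hlt' hN
  have hiff : ∀ {a c : X}, E a c → ¬ Refine lt lt' E a c → (lt a c ↔ lt' a c) :=
    lt_iff_lt_of_not_refine hI hlt hlt' hE hN
  have hsub : ∀ B : Set X, B ⊆ C → (∀ x ∈ B, ∀ y, Refine lt lt' E x y → y ∈ C → y ∈ B) →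
      (∀ x ∈ B, ∀ y ∈ B, Refine lt lt' E x y) → FinConv lt' B := by
    intro B hBC hB hBR
    refine hfin B (fun a ha b hb c hac hcb => ?_) hBR
    exact hB a ha c (hR.left a c b hac hcb (hBR a ha b hb))
      (hC a (hBC ha) b (hBC hb) c hac hcb)
  -- C₁ collects the refined classes contained in C, and is <'-convex because the orders agree
  -- between classes. The classes cut by C contribute only the lower end C₃ or the upper end C₂ of
  -- C's complement inside them: each of C₂ and C₃ lies in one class, where `hfin` applies.
  let C₁ : Set X := {c | c ∈ C ∧ ∀ y, Refine lt lt' E c y → y ∈ C}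
  let C₂ : Set X := {c | c ∈ C ∧ ∃ y, Refine lt lt' E c y ∧ y ∉ C ∧ lt y c}
  let C₃ : Set X := {c | c ∈ C ∧ ∃ y, Refine lt lt' E c y ∧ y ∉ C ∧ lt c y}
  have h₁ : FinConv lt' C₁ := by
    refine IsConvexIn.finConv fun a ha b hb c hac hcb => ?_
    have hEac := hE.right a c b hac hcb (hCE a ha.1 b hb.1)
    have hEcb := hE.equiv.trans (hE.equiv.symm hEac) (hCE a ha.1 b hb.1)
    by_cases hRac : Refine lt lt' E a c
    · exact ⟨ha.2 c hRac, fun y hy => ha.2 y (hR.equiv.trans hRac hy)⟩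
    by_cases hRcb : Refine lt lt' E c b
    · exact ⟨hb.2 c (hR.equiv.symm hRcb), fun y hy =>
        hb.2 y (hR.equiv.trans (hR.equiv.symm hRcb) hy)⟩
    have key : ∀ y, Refine lt lt' E c y → y ∈ C := by
      intro y hy
      have hay : ¬ Refine lt lt' E a y := fun h => hRac (hR.equiv.trans h (hR.equiv.symm hy))
      have hyb : ¬ Refine lt lt' E y b := fun h => hRcb (hR.equiv.trans hy h)
      have hlac := (hiff hEac hRac).2 hac
      have hlcb := (hiff hEcb hRcb).2 hcb
      refine hC a ha.1 b hb.1 y ?_ ?_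
      · by_contra hcon
        have hya : lt y a := lt_of_not_lt_of_ne hcon fun h => hay (h ▸ hR.equiv.refl _)
        exact hay (hR.equiv.symm (hR.left y a c hya hlac (hR.equiv.symm hy)))
      · by_contra hcon
        have hby : lt b y := lt_of_not_lt_of_ne hcon fun h => hyb (h ▸ hR.equiv.refl _)
        exact hRcb (hR.left c b y hlcb hby hy)
    exact ⟨key c (hR.equiv.refl c), key⟩
  have h₂ : FinConv lt' C₂ := by
    refine hsub C₂ (fun x hx => hx.1) ?_ ?_
    · rintro x ⟨hx, z, hxz, hz, hzx⟩ y hxy hy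
      refine ⟨hy, z, hR.equiv.trans (hR.equiv.symm hxy) hxz, hz, ?_⟩
      by_contra hcon
      have hyz : lt y z := lt_of_not_lt_of_ne hcon fun h => hz (h ▸ hy)
      exact hz (hC y hy x hx z hyz hzx)
    · have key : ∀ x ∈ C₂, ∀ y ∈ C₂, lt x y → Refine lt lt' E x y := by
        rintro x ⟨hx, -⟩ y ⟨hy, z, hyz, hz, hzy⟩ hxy
        have hzx : lt z x := by
          refine lt_of_not_lt_of_ne (fun h => hz (hC x hx y hy z h hzy)) ?_
          rintro rfl
          exact hz hx
        have := hR.left z x y hzx hxy (hR.equiv.symm hyz)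
        exact hR.equiv.trans (hR.equiv.symm this) (hR.equiv.symm hyz)
      intro x hx y hy
      rcases trichotomous_of lt x y with h | rfl | h
      · exact key x hx y hy h
      · exact hR.equiv.refl x
      · exact hR.equiv.symm (key y hy x hx h)
  have h₃ : FinConv lt' C₃ := by
    refine hsub C₃ (fun x hx => hx.1) ?_ ?_
    · rintro x ⟨hx, z, hxz, hz, hxz'⟩ y hxy hy
      refine ⟨hy, z, hR.equiv.trans (hR.equiv.symm hxy) hxz, hz, ?_⟩
      by_contra hcon
      have hzy : lt z y := lt_of_not_lt_of_ne hcon fun h => hz (h ▸ hy)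
      exact hz (hC x hx y hy z hxz' hzy)
    · have key : ∀ x ∈ C₃, ∀ y ∈ C₃, lt x y → Refine lt lt' E x y := by
        rintro x ⟨hx, z, hxz, hz, hxz'⟩ y ⟨hy, -⟩ hxy
        have hyz : lt y z := by
          refine lt_of_not_lt_of_ne (fun h => hz (hC x hx y hy z hxz' h)) ?_
          rintro rfl
          exact hz hy
        exact hR.left x y z hxy hyz hxz
      intro x hx y hy
      rcases trichotomous_of lt x y with h | rfl | h
      · exact key x hx y hy h
      · exact hR.equiv.refl x
      · exact hR.equiv.symm (key y hy x hx h)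
  convert (h₁.union h₂).union h₃ using 1
  refine subset_antisymm (fun x hx => ?_) ?_
  · by_cases h : ∀ y, Refine lt lt' E x y → y ∈ C
    · exact Or.inl (Or.inl ⟨hx, h⟩)
    · push Not at h
      obtain ⟨y, hxy, hy⟩ := h
      rcases trichotomous_of lt x y with h | rfl | h
      · exact Or.inr ⟨hx, y, hxy, hy, h⟩
      · exact absurd hx hy
      · exact Or.inl (Or.inr ⟨hx, y, hxy, hy, h⟩)
  · rintro x ((h | h) | h) <;> exact h.1

end Refine

end Order

/-! ### Independence of weak o-minimality from the order -/

section OrderChange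

variable {X : Type w} {I : Set (X × X) → Prop} {lt : X → X → Prop}

theorem FinConv.swap {lt' : X → X → Prop} {D : Set X} (h : FinConv (Function.swap lt') D) :
    FinConv lt' D := by
  obtain ⟨𝒞, hf, hc, rfl⟩ := h
  exact ⟨𝒞, hf, fun C hC a ha b hb c hac hcb => hc C hC b hb a ha c hcb hac, rfl⟩

/-- Above `z` in its `E`-class, chains of length `n` do not alternate between `<' z` and `>' z`. -/
def AltBound (lt lt' E : X → X → Prop) (n : ℕ) : Prop :=
  ∀ z, ¬ Alt lt (fun y => E z y ∧ lt z y) (fun y => lt' y z) n z ∧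
    ¬ Alt lt (fun y => E z y ∧ lt z y) (fun y => lt' z y) n z

variable [IsStrictTotalOrder X lt]

/-- Otherwise both sides of z in <' are cofinal in the part of the class above z, which gives chains
of every length. -/
theorem AltBound.exists_finalSeg {lt' E : X → X → Prop} [IsStrictTotalOrder X lt'] {n : ℕ}
    (h : AltBound lt lt' E n) {z : X} (hz : ∃ y, E z y ∧ lt z y) :
    (∃ x, FinalSeg lt lt' E z x) ∨ ∃ x, FinalSeg lt (Function.swap lt') E z x := by
  by_contra! hcon
  obtain ⟨h₁, h₂⟩ := hcon
  have h₁' : ∀ w, E z w → lt z w → ∃ y, ¬ lt y w ∧ E z y ∧ lt z y ∧ lt' y z := by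
    intro w hw hzw
    by_contra! hcon
    refine h₁ w ⟨hw, hzw, fun y hy hyw => ?_⟩
    have hzy := lt_of_lt_of_not_lt hzw hyw
    refine lt_of_not_lt_of_ne (hcon y hyw hy hzy) ?_
    rintro rfl
    exact irrefl_of lt z hzy
  have h₂' : ∀ w, E z w → lt z w → ∃ y, ¬ lt y w ∧ E z y ∧ lt z y ∧ lt' z y := by
    intro w hw hzw
    by_contra! hcon
    refine h₂ w ⟨hw, hzw, fun y hy hyw => ?_⟩
    have hzy := lt_of_lt_of_not_lt hzw hyw
    refine lt_of_not_lt_of_ne (hcon y hyw hy hzy) ?_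
    rintro rfl
    exact irrefl_of lt _ hzy
  have key : ∀ m w, E z w → lt z w →
      Alt lt (fun y => E z y ∧ lt z y) (fun y => lt' y z) m w := by
    intro m
    induction m with
    | zero => exact fun _ _ _ => trivial
    | succ m ih =>
      intro w hw hzw
      by_cases hm : Even m
      · obtain ⟨y, hyw, hy, hzy, hyz'⟩ := h₁' w hw hzw
        exact ⟨y, hyw, ⟨hy, hzy⟩, iff_of_true hyz' hm, ih y hy hzy⟩
      · obtain ⟨y, hyw, hy, hzy, hyz'⟩ := h₂' w hw hzw
        exact ⟨y, hyw, ⟨hy, hzy⟩, iff_of_false (asymm_of lt' hyz') hm, ih y hy hzy⟩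
  obtain ⟨w, hw, hzw⟩ := hz
  exact (h z).1 ((key n w hw hzw).of_not_lt (asymm_of lt hzw))

theorem AltBound.refine {lt' E : X → X → Prop} [IsStrictTotalOrder X lt'] {n : ℕ}
    (hE : Equivalence E) (h : AltBound lt lt' E (n + 1))
    (hF : ∀ z, ∃ x, FinalSeg lt lt' E z x) : AltBound lt lt' (Refine lt lt' E) n := by
  intro z
  have hne : ∀ y, lt z y → (lt' z y ↔ ¬ lt' y z) := fun y hy =>
    ⟨fun h => asymm_of lt' h, fun h => lt_of_not_lt_of_ne h (by rintro rfl; exact irrefl_of lt z hy)⟩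
  -- A chain ending below z in <' is extended by a point of F(z).
  have h₁ : ∀ m w, E z w →
      Alt lt (fun y => Refine lt lt' E z y ∧ lt z y) (fun y => lt' y z) m w →
      Alt lt (fun y => E z y ∧ lt z y) (fun y => lt' z y) (m + 1) w := by
    intro m
    induction m with
    | zero =>
      intro w hw _
      obtain ⟨x, hx⟩ := hF z
      obtain ⟨y, hyw, hy⟩ : ∃ y, ¬ lt y w ∧ FinalSeg lt lt' E z y := by
        by_cases hwx : lt w x
        · exact ⟨x, asymm_of lt hwx, hx⟩
        · exact ⟨w, irrefl_of lt w, hx.of_not_lt hwx hw⟩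
      exact ⟨y, hyw, ⟨hy.1, hy.2.1⟩, iff_of_true (hy.2.2 y hy.1 (irrefl_of lt y)) (by simp),
        trivial⟩
    | succ m ih =>
      rintro w - ⟨y, hyw, ⟨hRy, hzy⟩, hy, halt⟩
      exact ⟨y, hyw, ⟨hRy.1, hzy⟩, (hne y hzy).trans
        ((not_congr hy).trans Nat.even_add_one.symm), ih y hRy.1 halt⟩
  -- A chain ending above z in <' is extended by a point below z: a point w > z of the refined class
  -- is not in F(w) = F(z), so some y ≥ w in the class is below z in <'.
  have h₂ : ∀ m w, Refine lt lt' E z w → lt z w →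
      Alt lt (fun y => Refine lt lt' E z y ∧ lt z y) (fun y => lt' z y) m w →
      Alt lt (fun y => E z y ∧ lt z y) (fun y => lt' y z) (m + 1) w := by
    intro m
    induction m with
    | zero =>
      intro w hw hzw _
      obtain ⟨y, hy, hyw, hzy⟩ : ∃ y, E z y ∧ ¬ lt y w ∧ ¬ lt' z y := by
        by_contra! hcon
        exact not_finalSeg_self ((hw.2 w).1 ⟨hw.1, hzw, hcon⟩)
      have hlt := lt_of_lt_of_not_lt hzw hyw
      exact ⟨y, hyw, ⟨hy, hlt⟩,
        iff_of_true (not_not.1 (mt (hne y hlt).2 hzy)) (by simp), trivial⟩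
    | succ m ih =>
      rintro w - - ⟨y, hyw, ⟨hRy, hzy⟩, hy, halt⟩
      refine ⟨y, hyw, ⟨hRy.1, hzy⟩, ?_, ih y hRy hzy halt⟩
      have := hne y hzy
      have : lt' z y ↔ Even m := hy
      grind
  refine ⟨fun halt => (h z).2 (h₁ n z (hE.refl z) halt), fun halt => ?_⟩
  cases n with
  | zero => exact (h z).2 (h₁ 0 z (hE.refl z) trivial)
  | succ n =>
    obtain ⟨y, hyz, ⟨hRy, hzy⟩, hy, halt⟩ := halt
    refine (h z).1 ⟨y, hyz, ⟨hRy.1, hzy⟩, ?_, h₂ n y hRy hzy halt⟩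
    have := hne y hzy
    have : lt' z y ↔ Even n := hy
    grind

/-- Induction on n with `lt'` and `E` varying: each step refines `E` and may reverse `lt'`. Reversal
exchanges `hN` and `hN'`, so both are carried along. -/
theorem finConv_of_altBound (hI : IsBackAndForth I) (hlt : IsInvariant I lt) {N : ℕ} (n : ℕ)
    (lt' E : X → X → Prop) [IsStrictTotalOrder X lt']
    (hlt' : IsInvariant I lt') (hE : IsBiconvex I lt lt' E)
    (hN : ∀ z w, ¬ Alt lt (fun _ => True) (fun y => lt' y z) N w)
    (hN' : ∀ z w, ¬ Alt lt (fun _ => True) (fun y => lt' z y) N w)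
    (hn : AltBound lt lt' E n) (C : Set X) (hC : IsConvexIn lt C)
    (hCE : ∀ x ∈ C, ∀ y ∈ C, E x y) : FinConv lt' C := by
  induction n generalizing lt' E C with
  | zero =>
    -- The empty chain always exists, so `AltBound` with n = 0 leaves no points.
    rcases C.eq_empty_or_nonempty with rfl | ⟨z, -⟩
    · exact isConvexIn_empty.finConv
    · exact ((hn z).1 trivial).elim
  | succ n ih =>
    have step : ∀ (lt' : X → X → Prop) [IsStrictTotalOrder X lt'], IsInvariant I lt' →
        IsBiconvex I lt lt' E →
        (∀ z w, ¬ Alt lt (fun _ => True) (fun y => lt' y z) N w) →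
        (∀ z w, ¬ Alt lt (fun _ => True) (fun y => lt' z y) N w) →
        AltBound lt lt' E (n + 1) → (∃ z x, FinalSeg lt lt' E z x) → FinConv lt' C := by
      intro lt' _ hlt' hE hN hN' hn hF
      obtain ⟨z, x, hzx⟩ := hF
      have hF : ∀ z, ∃ x, FinalSeg lt lt' E z x := by
        intro z'
        obtain ⟨x', hx'⟩ := hI.forth _ (hI.single z z') x
        exact ⟨x', (IsInvariant.finalSeg hI hlt hlt' hE.invariant _ hx' z z' x x' (by simp)
          (by simp)).1 hzx⟩
      exact finConv_of_refine hI hlt hlt' hE hN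
        (ih lt' _ hlt' (hE.refine hI hlt hlt' hN) hN hN' (hn.refine hE.equiv hF)) hC hCE
    -- If one point is maximal in its class then, by homogeneity, every point is; so `E`-classes are
    -- singletons and C has at most one point.
    by_cases hmax : ∃ m, ∀ y, E m y → ¬ lt m y
    · obtain ⟨m, hm⟩ := hmax
      have hall : ∀ a y, E a y → ¬ lt a y := by
        intro a y hay hlay
        obtain ⟨y', hy'⟩ := hI.back _ (hI.single m a) y
        exact hm y' ((hE.invariant _ hy' m a y' y (by simp) (by simp)).2 hay)
          ((hlt _ hy' m a y' y (by simp) (by simp)).2 hlay)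
      refine IsConvexIn.finConv fun a ha b hb c hac hcb => ?_
      have hab : a = b := by
        rcases trichotomous_of lt a b with h | h | h
        · exact (hall a b (hCE a ha b hb) h).elim
        · exact h
        · exact (hall b a (hCE b hb a ha) h).elim
      subst hab
      exact (asymm_of lt' hac hcb).elim
    · push Not at hmax
      rcases C.eq_empty_or_nonempty with rfl | ⟨z, -⟩
      · exact isConvexIn_empty.finConv
      rcases hn.exists_finalSeg (hmax z) with h | h
      · exact step lt' hlt' hE hN hN' hn ⟨z, h⟩
      · exact (step (Function.swap lt') hlt'.flip hE.swap hN' hN (fun z => (hn z).symm)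
          ⟨z, h⟩).swap

/-- Convex sets of one invariant order are finite unions of convex sets of another one. -/
theorem FinConv.of_invariant (hI : IsBackAndForth I) {lt' : X → X → Prop}
    [IsStrictTotalOrder X lt'] (hlt : IsInvariant I lt) (hlt' : IsInvariant I lt')
    (hfin : ∀ z, FinConv lt {y | lt' y z}) (hfin' : ∀ z, FinConv lt {y | lt' z y})
    {D : Set X} (hD : FinConv lt D) : FinConv lt' D := by
  obtain ⟨N₁, h₁⟩ := exists_forall_not_alt hI hlt hlt' hfin
  obtain ⟨N₂, h₂⟩ := exists_forall_not_alt hI hlt hlt'.flip hfin'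
  have h₁' : ∀ z w, ¬ Alt lt (fun _ => True) (fun y => lt' y z) (max N₁ N₂) w :=
    fun z w h => h₁ z w (h.of_le (le_max_left _ _))
  have h₂' : ∀ z w, ¬ Alt lt (fun _ => True) (fun y => lt' z y) (max N₁ N₂) w :=
    fun z w h => h₂ z w (h.of_le (le_max_right _ _))
  obtain ⟨𝒞, hf, hc, rfl⟩ := hD
  refine FinConv.sUnion hf fun C hC => ?_
  -- The induction starts from the relation with a single class.
  refine finConv_of_altBound hI hlt (max N₁ N₂) lt' (fun _ _ => True) hlt' ?_ h₁' h₂' ?_ C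
    (hc C hC) fun _ _ _ _ => trivial
  · exact ⟨⟨fun _ => trivial, fun _ => trivial, fun _ _ => trivial⟩,
      fun _ _ _ _ _ _ _ _ => Iff.rfl, fun _ _ _ _ _ _ => trivial, fun _ _ _ _ _ _ => trivial⟩
  · exact fun z => ⟨fun h => h₁' z z (h.mono (fun _ _ => trivial) fun _ _ => Iff.rfl),
      fun h => h₂' z z (h.mono (fun _ _ => trivial) fun _ _ => Iff.rfl)⟩

end OrderChange

/-! ### Compactness in an ℵ₀-saturated structure -/

section Saturation

variable {L : FirstOrder.Language.{u, v}} {M : Type w} [L.Structure M]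

theorem IsSaturated.exists_realize_one (hM : IsSaturated L M Cardinal.aleph0) {α : Type x}
    [Finite α] (v : α → M) (Γ : Set (L.Formula (α ⊕ Fin 1)))
    (h : ∀ Δ ⊆ Γ, Δ.Finite → ∃ a : M, ∀ φ ∈ Δ, φ.Realize (Sum.elim v fun _ => a)) :
    ∃ a : M, ∀ φ ∈ Γ, φ.Realize (Sum.elim v fun _ => a) := by
  let A : Set M := Set.range v
  let f : α ⊕ Fin 1 → A ⊕ Fin 1 := Sum.map (fun i => ⟨v i, i, rfl⟩) id
  let c : L.Formula (α ⊕ Fin 1) → L[[A]].Formula (Fin 1) := fun φ =>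
    BoundedFormula.constantsVarsEquiv.symm (φ.relabel f)
  have hc : ∀ φ a, (c φ).Realize (fun _ => a) ↔ φ.Realize (Sum.elim v fun _ => a) := by
    intro φ a
    have : (c φ).Realize (fun _ => a) ↔
        (φ.relabel f).Realize (Sum.elim (fun a : A => (a : M)) fun _ => a) := by
      rw [Formula.Realize, ← BoundedFormula.realize_constantsVarsEquiv, Equiv.apply_symm_apply]
      rfl
    rw [this, Formula.realize_relabel]
    congr! 1
    funext i
    cases i <;> rfl
  obtain ⟨a, ha⟩ := hM A (Cardinal.lt_aleph0_iff_finite.2 (Set.finite_range v)) (c '' Γ) (by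
    intro Δ hΔ hfin
    replace hΔ : ∀ φ ∈ Δ, _ := fun φ hφ => hΔ hφ
    choose! g hg hg' using hΔ
    obtain ⟨a, ha⟩ := h (g '' Δ) (by rintro _ ⟨φ, hφ, rfl⟩; exact hg φ hφ) (hfin.image g)
    refine ⟨a, fun φ hφ => ?_⟩
    rw [← hg' φ hφ, hc]
    exact ha _ ⟨φ, hφ, rfl⟩)
  exact ⟨a, fun φ hφ => (hc φ a).1 (ha _ ⟨φ, hφ, rfl⟩)⟩

/-- Saturation for formulas in several variables. -/
theorem IsSaturated.exists_realize (hM : IsSaturated L M Cardinal.aleph0) (β : Type y)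
    [Finite β] : ∀ {α : Type x} [Finite α] (v : α → M) (Γ : Set (L.Formula (α ⊕ β))),
    (∀ Δ ⊆ Γ, Δ.Finite → ∃ w : β → M, ∀ φ ∈ Δ, φ.Realize (Sum.elim v w)) →
    ∃ w : β → M, ∀ φ ∈ Γ, φ.Realize (Sum.elim v w) := by
  induction β using Finite.induction_empty_option with
  | of_equiv e ih =>
    intro α _ v Γ h
    have he : ∀ (φ : L.Formula (α ⊕ _)) (w : _ → M),
        (φ.relabel (Sum.map id e.symm)).Realize (Sum.elim v w) ↔
          φ.Realize (Sum.elim v (w ∘ e.symm)) := by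
      intro φ w
      rw [Formula.realize_relabel, Sum.elim_comp_map, Function.comp_id]
    obtain ⟨w, hw⟩ := ih v ((fun φ => φ.relabel (Sum.map id e.symm)) '' Γ) (by
      intro Δ hΔ hfin
      replace hΔ : ∀ φ ∈ Δ, _ := fun φ hφ => hΔ hφ
      choose! g hg hg' using hΔ
      obtain ⟨w, hw⟩ := h (g '' Δ) (by rintro _ ⟨φ, hφ, rfl⟩; exact hg φ hφ) (hfin.image g)
      refine ⟨w ∘ e, fun φ hφ => ?_⟩
      rw [← hg' φ hφ, he]
      convert hw _ ⟨φ, hφ, rfl⟩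
      funext i
      simp)
    exact ⟨w ∘ e.symm, fun φ hφ => (he φ w).1 (hw _ ⟨φ, hφ, rfl⟩)⟩
  | h_empty =>
    intro α _ v Γ h
    refine ⟨PEmpty.elim, fun φ hφ => ?_⟩
    obtain ⟨w, hw⟩ := h {φ} (by simpa using hφ) (Set.finite_singleton φ)
    convert hw φ rfl
    exact Subsingleton.elim _ _
  | h_option ih =>
    rename_i β _
    intro α _ v Γ h
    let e : α ⊕ Option β → (α ⊕ Fin 1) ⊕ β :=
      Sum.elim (fun i => .inl (.inl i)) fun o => o.elim (.inl (.inr 0)) fun b => .inr b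
    have he : ∀ (φ : L.Formula (α ⊕ Option β)) (a : M) (w : β → M),
        (φ.relabel e).Realize (Sum.elim (Sum.elim v fun _ => a) w) ↔
          φ.Realize (Sum.elim v fun o => o.elim a w) := by
      intro φ a w
      rw [Formula.realize_relabel]
      congr! 1
      funext i
      rcases i with i | _ | i <;> rfl
    -- Every formula in the new single variable that follows from solvability of a finite part of Γ;
    -- it contains the existential closures over β used below.
    let Γ₁ : Set (L.Formula (α ⊕ Fin 1)) := {ψ | ∃ Δ ⊆ Γ, Δ.Finite ∧ ∀ a : M,
      (∃ w : β → M, ∀ φ ∈ Δ, φ.Realize (Sum.elim v fun o : Option β => o.elim a w)) →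
        ψ.Realize (Sum.elim v fun _ => a)}
    obtain ⟨a, ha⟩ := hM.exists_realize_one v Γ₁ (by
      intro Δ₁ hΔ₁ hfin
      replace hΔ₁ : ∀ φ ∈ Δ₁, _ := fun φ hφ => hΔ₁ hφ
      choose! g hg hg' hg'' using hΔ₁
      obtain ⟨w, hw⟩ := h (⋃ ψ ∈ Δ₁, g ψ) (Set.iUnion₂_subset fun ψ hψ => hg ψ hψ)
        (hfin.biUnion fun ψ hψ => hg' ψ hψ)
      refine ⟨w none, fun ψ hψ => hg'' ψ hψ _ ⟨fun b => w (some b), fun φ hφ => ?_⟩⟩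
      convert hw φ (Set.mem_biUnion hψ hφ) using 2
      funext o
      cases o <;> rfl)
    obtain ⟨w, hw⟩ := ih (Sum.elim v fun _ : Fin 1 => a) ((fun φ => φ.relabel e) '' Γ) (by
      intro Δ hΔ hfin
      replace hΔ : ∀ φ ∈ Δ, _ := fun φ hφ => hΔ hφ
      choose! g hg hg' using hΔ
      have : Finite Δ := hfin
      have hmem : (Formula.iInf fun φ : Δ => (φ : L.Formula ((α ⊕ Fin 1) ⊕ β))).iExs β ∈ Γ₁ := by
        refine ⟨g '' Δ, by rintro _ ⟨φ, hφ, rfl⟩; exact hg φ hφ, hfin.image g, fun a => ?_⟩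
        rintro ⟨w, hw⟩
        rw [Formula.realize_iExs]
        refine ⟨w, Formula.realize_iInf.2 ?_⟩
        rintro ⟨φ, hφ⟩
        refine (congrArg (fun χ => Formula.Realize χ _) (hg' φ hφ)).mp ?_
        exact (he _ _ _).2 (hw _ ⟨φ, hφ, rfl⟩)
      obtain ⟨w, hw⟩ := Formula.realize_iExs.1 (ha _ hmem)
      exact ⟨w, fun φ hφ => Formula.realize_iInf.1 hw ⟨φ, hφ⟩⟩)
    exact ⟨fun o => o.elim a w, fun φ hφ => (he φ a w).1 (hw _ ⟨φ, hφ, rfl⟩)⟩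

/-- A directed family of formulas indexed by the type of `c` is realized as soon as each of its
members is. -/
theorem IsSaturated.exists_realize_of_directed (hM : IsSaturated L M Cardinal.aleph0)
    {α : Type x} [Finite α] {β : Type y} [Finite β] (v : α → M) (c : M)
    (F : L.Formula (Fin 1) → L.Formula (α ⊕ β))
    (hF : ∀ ψ ψ' w, (∀ a : M, ψ.Realize (fun _ => a) → ψ'.Realize (fun _ => a)) →
      (F ψ).Realize (Sum.elim v w) → (F ψ').Realize (Sum.elim v w))
    (h : ∀ ψ : L.Formula (Fin 1), ψ.Realize (fun _ => c) → ∃ w, (F ψ).Realize (Sum.elim v w)) :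
    ∃ w, ∀ ψ : L.Formula (Fin 1), ψ.Realize (fun _ => c) → (F ψ).Realize (Sum.elim v w) := by
  obtain ⟨w, hw⟩ := hM.exists_realize β v (F '' {ψ | ψ.Realize fun _ => c}) (by
    intro Δ hΔ hfin
    have : Finite Δ := hfin
    replace hΔ : ∀ φ ∈ Δ, _ := fun φ hφ => hΔ hφ
    choose! g hg hg' using hΔ
    obtain ⟨w, hw⟩ := h (Formula.iInf fun δ : Δ => g δ)
      (Formula.realize_iInf.2 fun δ => hg δ δ.2)
    refine ⟨w, fun φ hφ => ?_⟩
    rw [← hg' φ hφ]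
    exact hF _ _ w (fun a ha => Formula.realize_iInf.1 ha ⟨φ, hφ⟩) hw)
  exact ⟨w, fun ψ hψ => hw _ ⟨ψ, hψ, rfl⟩⟩

theorem IsSaturated.exists_finite_cover (hM : IsSaturated L M Cardinal.aleph0)
    (G : Set (L.Formula (Fin 1))) (hG : ∀ c : M, ∃ ψ ∈ G, ψ.Realize fun _ => c) :
    ∃ G₀ ⊆ G, G₀.Finite ∧ ∀ c : M, ∃ ψ ∈ G₀, ψ.Realize fun _ => c := by
  by_contra! hcon
  have hr : ∀ (ψ : L.Formula (Fin 1)) (a : M),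
      (Formula.relabel (Sum.inr : Fin 1 → Empty ⊕ Fin 1) (∼ψ)).Realize
        (Sum.elim Empty.elim fun _ => a) ↔ ¬ ψ.Realize fun _ => a := by
    intro ψ a
    rw [Formula.realize_relabel, Formula.realize_not]
    rfl
  obtain ⟨a, ha⟩ := hM.exists_realize_one (Empty.elim : Empty → M)
    ((fun ψ => Formula.relabel Sum.inr (∼ψ)) '' G) (by
    intro Δ hΔ hfin
    replace hΔ : ∀ φ ∈ Δ, _ := fun φ hφ => hΔ hφ
    choose! g hg hg' using hΔ
    obtain ⟨a, ha⟩ := hcon (g '' Δ) (by rintro _ ⟨φ, hφ, rfl⟩; exact hg φ hφ) (hfin.image g)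
    refine ⟨a, fun φ hφ => ?_⟩
    rw [← hg' φ hφ]
    exact (hr _ a).2 (ha _ ⟨φ, hφ, rfl⟩))
  obtain ⟨ψ, hψ, hψa⟩ := hG a
  exact (hr ψ a).1 (ha _ ⟨ψ, hψ, rfl⟩) hψa

theorem IsSaturated.exists_extend (hM : IsSaturated L M Cardinal.aleph0) {α : Type x} [Finite α]
    {v v' : α → M} (h : ∀ φ : L.Formula α, φ.Realize v → φ.Realize v') (a : M) :
    ∃ a' : M, ∀ φ : L.Formula (α ⊕ Fin 1),
      φ.Realize (Sum.elim v fun _ => a) ↔ φ.Realize (Sum.elim v' fun _ => a') := by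
  obtain ⟨a', ha'⟩ := hM.exists_realize_one v' {φ | φ.Realize (Sum.elim v fun _ => a)} (by
    intro Δ hΔ hfin
    have : Finite Δ := hfin
    obtain ⟨w, hw⟩ := Formula.realize_iExs.1 (h
      ((Formula.iInf fun φ : Δ => (φ : L.Formula (α ⊕ Fin 1))).iExs (Fin 1))
      (Formula.realize_iExs.2 ⟨fun _ => a, Formula.realize_iInf.2 fun φ => hΔ φ.2⟩))
    refine ⟨w 0, fun φ hφ => ?_⟩
    convert Formula.realize_iInf.1 hw ⟨φ, hφ⟩ using 2
    funext i
    rw [Subsingleton.elim i 0])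
  refine ⟨a', fun φ => ⟨ha' φ, fun hφ => ?_⟩⟩
  by_contra hcon
  exact Formula.realize_not.1 (ha' (∼φ) (Formula.realize_not.2 hcon)) hφ

/-- Graphs of finite partial elementary maps between points of `P`. -/
def PartialElementary (L : FirstOrder.Language.{u, v}) {M : Type w} [L.Structure M] (P : Set M)
    (S : Set (P × P)) : Prop :=
  S.Finite ∧ ∀ φ : L.Formula S,
    φ.Realize (fun s => (s.1.1 : M)) ↔ φ.Realize fun s => (s.1.2 : M)

theorem partialElementary_insert {P : Set M} {S : Set (P × P)} (hS : PartialElementary L P S)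
    {a b : P} (h : ∀ φ : L.Formula (S ⊕ Fin 1),
      φ.Realize (Sum.elim (fun s => (s.1.1 : M)) fun _ => (a : M)) ↔
        φ.Realize (Sum.elim (fun s => (s.1.2 : M)) fun _ => (b : M))) :
    PartialElementary L P (insert (a, b) S) := by
  classical
  refine ⟨hS.1.insert _, fun φ => ?_⟩
  let f : ↥(insert (a, b) S) → S ⊕ Fin 1 := fun s => if hs : s.1 ∈ S then .inl ⟨s.1, hs⟩ else .inr 0
  have hf : ∀ s (hs : s.1 ∉ S), f s = .inr 0 := fun s hs => dif_neg hs
  have hf' : ∀ s (hs : s.1 ∈ S), f s = .inl ⟨s.1, hs⟩ := fun s hs => dif_pos hs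
  convert h (φ.relabel f) using 1
  · rw [Formula.realize_relabel]
    congr! 1
    funext s
    by_cases hs : s.1 ∈ S
    · simp [hf' s hs]
    · simp [hf s hs, s.2.resolve_right hs]
  · rw [Formula.realize_relabel]
    congr! 1
    funext s
    by_cases hs : s.1 ∈ S
    · simp [hf' s hs]
    · simp [hf s hs, s.2.resolve_right hs]

theorem isInvariant_realize (P : Set M) (θ : L.Formula (Fin 2)) :
    IsInvariant (PartialElementary L P) fun x y : P => θ.Realize ![(x : M), y] := by
  intro S hS a a' b b' ha hb
  have := hS.2 (θ.relabel ![⟨(a, a'), ha⟩, ⟨(b, b'), hb⟩])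
  rw [Formula.realize_relabel, Formula.realize_relabel] at this
  convert this using 2
  · funext i
    fin_cases i <;> rfl
  · funext i
    fin_cases i <;> rfl

end Saturation

/-! ### Homogeneity of the locus of a type -/

section Locus

variable {L : FirstOrder.Language.{u, v}} {T : L.Theory} {M : Type w} [L.Structure M] [M ⊨ T]
  [Nonempty M]

theorem typeOf_eq_typeOf_iff {a c : M} :
    T.typeOf (fun _ : Fin 1 => a) = T.typeOf (fun _ : Fin 1 => c) ↔
      ∀ ψ : L.Formula (Fin 1), ψ.Realize (fun _ => c) → ψ.Realize fun _ => a := by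
  constructor
  · intro h ψ hψ
    rw [← Theory.CompleteType.formula_mem_typeOf (T := T)] at hψ ⊢
    rwa [h]
  · intro h
    refine SetLike.ext fun φ => ?_
    rw [Theory.CompleteType.mem_typeOf, Theory.CompleteType.mem_typeOf]
    refine ⟨fun h' => ?_, h _⟩
    by_contra hcon
    exact Formula.realize_not.1 (h _ (Formula.realize_not.2 hcon)) h'

theorem realize_iff_of_mem_locus {p : T.CompleteType (Fin 1)} {a c : M} (ha : a ∈ locus p M)
    (hc : c ∈ locus p M) (ψ : L.Formula (Fin 1)) :
    ψ.Realize (fun _ => a) ↔ ψ.Realize fun _ => c := by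
  have ha' : T.typeOf (fun _ : Fin 1 => a) = p := ha
  have hc' : T.typeOf (fun _ : Fin 1 => c) = p := hc
  exact ⟨typeOf_eq_typeOf_iff.1 (hc'.trans ha'.symm) ψ, typeOf_eq_typeOf_iff.1 (ha'.trans hc'.symm) ψ⟩

theorem isBackAndForth_partialElementary (hM : IsSaturated L M Cardinal.aleph0)
    (p : T.CompleteType (Fin 1)) : IsBackAndForth (PartialElementary L (locus p M)) where
  single a b := by
    refine ⟨Set.finite_singleton _, fun φ => ?_⟩
    have := realize_iff_of_mem_locus a.2 b.2 (φ.relabel fun _ => 0)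
    rw [Formula.realize_relabel, Formula.realize_relabel] at this
    convert this using 2
    · funext s
      rw [s.2]
      rfl
    · funext s
      rw [s.2]
      rfl
  forth S hS a := by
    have : Finite S := hS.1
    obtain ⟨b, hb⟩ := hM.exists_extend (fun φ => (hS.2 φ).1) a
    have hbp : b ∈ locus p M := by
      refine (typeOf_eq_typeOf_iff.2 fun ψ hψ => ?_).trans a.2
      have := (hb (ψ.relabel Sum.inr)).1
      rw [Formula.realize_relabel, Formula.realize_relabel] at this
      exact this hψ
    exact ⟨⟨b, hbp⟩, partialElementary_insert hS hb⟩
  back S hS b := by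
    have : Finite S := hS.1
    obtain ⟨a, ha⟩ := hM.exists_extend (fun φ => (hS.2 φ).2) b
    have hap : a ∈ locus p M := by
      refine (typeOf_eq_typeOf_iff.2 fun ψ hψ => ?_).trans b.2
      have := (ha (ψ.relabel Sum.inr)).1
      rw [Formula.realize_relabel, Formula.realize_relabel] at this
      exact this hψ
    exact ⟨⟨a, hap⟩, partialElementary_insert hS fun φ => (ha φ).symm⟩

end Locus

/-! ### Linear orders and alternation expressed by formulas -/

section Formulas

variable {L : FirstOrder.Language.{u, v}} {M : Type w} [L.Structure M]

/-- The relation `R` is a strict linear order on `Y`. -/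
def IsOrderOn {X : Type w} (R : X → X → Prop) (Y : Set X) : Prop :=
  ∀ x ∈ Y, ∀ y ∈ Y, ∀ z ∈ Y,
    ¬ R x x ∧ (R x y → R y z → R x z) ∧ (R x y ∨ x = y ∨ R y x)

/-- P is placed below the rest of Y, so overlaps do no harm. -/
theorem IsOrderOn.union {X : Type w} {R₁ R₂ : X → X → Prop} {P Y : Set X}
    (h₁ : IsOrderOn R₁ P) (h₂ : IsOrderOn R₂ Y) :
    IsOrderOn (fun x y => (x ∈ P ∧ y ∈ P ∧ R₁ x y) ∨ (x ∈ P ∧ y ∉ P) ∨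
      (x ∉ P ∧ y ∉ P ∧ R₂ x y)) (P ∪ Y) := by
  intro x hx y hy z hz
  have e₁ := h₁ x
  have e₂ := h₂ x
  by_cases hxP : x ∈ P <;> by_cases hyP : y ∈ P <;> by_cases hzP : z ∈ P <;>
    simp only [hxP, hyP, hzP, Set.mem_union, true_or, false_or] at hx hy hz <;> grind

/-- The three variables violate the axioms of strict linear orders for `θ`. -/
def notOrderFormula (θ : L.Formula (Fin 2)) : L.Formula (Fin 3) :=
  θ.relabel ![0, 0] ⊔
    ((θ.relabel ![0, 1] ⊓ θ.relabel ![1, 2] ⊓ Formula.not (θ.relabel ![0, 2])) ⊔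
    (Formula.not (θ.relabel ![0, 1]) ⊓ Formula.not (Term.equal (Term.var 0) (Term.var 1)) ⊓
      Formula.not (θ.relabel ![1, 0])))

theorem realize_relabel_pair {α : Type x} (θ : L.Formula (Fin 2)) (i j : α) (v : α → M) :
    (θ.relabel ![i, j]).Realize v ↔ θ.Realize ![v i, v j] := by
  rw [Formula.realize_relabel]
  congr! 1
  funext k
  fin_cases k <;> rfl

theorem realize_notOrderFormula (θ : L.Formula (Fin 2)) (v : Fin 3 → M) :
    (notOrderFormula θ).Realize v ↔ ¬ (¬ θ.Realize ![v 0, v 0] ∧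
      (θ.Realize ![v 0, v 1] → θ.Realize ![v 1, v 2] → θ.Realize ![v 0, v 2]) ∧
      (θ.Realize ![v 0, v 1] ∨ v 0 = v 1 ∨ θ.Realize ![v 1, v 0])) := by
  simp only [notOrderFormula, Formula.realize_sup, Formula.realize_inf, Formula.realize_not,
    realize_relabel_pair, Formula.realize_equal, Term.realize_var]
  tauto

theorem isOrderOn_iff (θ : L.Formula (Fin 2)) (Y : Set M) :
    IsOrderOn (fun a b => θ.Realize ![a, b]) Y ↔
      ∀ v : Fin 3 → M, (∀ i, v i ∈ Y) → ¬ (notOrderFormula θ).Realize v := by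
  simp only [realize_notOrderFormula, not_not]
  refine ⟨fun h v hv => h _ (hv 0) _ (hv 1) _ (hv 2), fun h x hx y hy z hz => ?_⟩
  exact h ![x, y, z] fun i => by fin_cases i <;> assumption

theorem IsOrderOn.isStrictTotalOrder {X : Type w} {R : X → X → Prop}
    (h : IsOrderOn R Set.univ) : IsStrictTotalOrder X R where
  trichotomous a b hab hba :=
    ((h a trivial b trivial a trivial).2.2.resolve_left hab).resolve_right hba
  irrefl a := (h a trivial a trivial a trivial).1
  trans a b c := (h a trivial b trivial c trivial).2.1

theorem isOrderOn_of_isStrictTotalOrder {P : Set M} {lt : P → P → Prop}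
    [IsStrictTotalOrder P lt] {R : M → M → Prop} (hR : ∀ x y : P, lt x y ↔ R x y) :
    IsOrderOn R P := by
  intro x hx y hy z hz
  have h1 := hR ⟨x, hx⟩ ⟨y, hy⟩
  have h2 := hR ⟨y, hy⟩ ⟨z, hz⟩
  have h3 := hR ⟨x, hx⟩ ⟨z, hz⟩
  have h4 := hR ⟨x, hx⟩ ⟨x, hx⟩
  have h5 := hR ⟨y, hy⟩ ⟨x, hx⟩
  refine ⟨fun h => irrefl_of lt _ (h4.2 h),
    fun h h' => h3.1 (trans_of lt (h1.2 h) (h2.2 h')), ?_⟩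
  rcases trichotomous_of lt (⟨x, hx⟩ : P) ⟨y, hy⟩ with h | h | h
  · exact .inl (h1.1 h)
  · exact .inr (.inl (congrArg Subtype.val h))
  · exact .inr (.inr (h5.1 h))

/-- The formula, in a new last variable, saying that it can be put below a chain of length `n`
described by `χ`. -/
noncomputable def altStep {α : Type x} (θ : L.Formula (Fin 2)) (ψ : L.Formula (Fin 1))
    (φ χ : L.Formula (α ⊕ Fin 1)) (n : ℕ) : L.Formula ((α ⊕ Fin 1) ⊕ Fin 1) :=
  Formula.not (θ.relabel ![.inr 0, .inl (.inr 0)]) ⊓ (ψ.relabel .inr ⊓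
    ((Formula.iff (φ.relabel (Sum.map .inl id)) (if Even n then ⊤ else ⊥)) ⊓
      χ.relabel (Sum.map .inl id)))

/-- The formula version of `Alt`. -/
noncomputable def altFormula {α : Type x} (θ : L.Formula (Fin 2)) (ψ : L.Formula (Fin 1))
    (φ : L.Formula (α ⊕ Fin 1)) : ℕ → L.Formula (α ⊕ Fin 1)
  | 0 => ⊤
  | n + 1 => (altStep θ ψ φ (altFormula θ ψ φ n) n).iExs (Fin 1)

theorem realize_altStep {α : Type x} (θ : L.Formula (Fin 2)) (ψ : L.Formula (Fin 1))
    (φ χ : L.Formula (α ⊕ Fin 1)) (n : ℕ) (v : α → M) (w : M) (i : Fin 1 → M) :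
    (altStep θ ψ φ χ n).Realize (Sum.elim (Sum.elim v fun _ => w) i) ↔
      ¬ θ.Realize ![i 0, w] ∧ ψ.Realize (fun _ => i 0) ∧
      (φ.Realize (Sum.elim v fun _ => i 0) ↔ Even n) ∧
      χ.Realize (Sum.elim v fun _ => i 0) := by
  have hc : Sum.elim (Sum.elim v fun _ => w) i ∘ Sum.map (Sum.inl : α → α ⊕ Fin 1) id =
      Sum.elim v fun _ => i 0 := by
    funext k
    rcases k with k | k
    · rfl
    · rw [Subsingleton.elim k 0]
      rfl
  have hψ : Sum.elim (Sum.elim v fun _ : Fin 1 => w) i ∘ Sum.inr = fun _ => i 0 := by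
    funext k
    rw [Subsingleton.elim k 0]
    rfl
  have hn : ∀ u : (α ⊕ Fin 1) ⊕ Fin 1 → M,
      ((if Even n then ⊤ else ⊥ : L.Formula ((α ⊕ Fin 1) ⊕ Fin 1)).Realize u ↔ Even n) := by
    intro u
    split_ifs with h <;> simp [h]
  rw [altStep, Formula.realize_inf, Formula.realize_inf, Formula.realize_inf, Formula.realize_not,
    realize_relabel_pair, Formula.realize_relabel, Formula.realize_iff, Formula.realize_relabel,
    Formula.realize_relabel, hc, hψ, hn]
  rfl

theorem realize_altFormula {α : Type x} (θ : L.Formula (Fin 2)) (ψ : L.Formula (Fin 1))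
    (φ : L.Formula (α ⊕ Fin 1)) (v : α → M) (n : ℕ) (w : M) :
    (altFormula θ ψ φ n).Realize (Sum.elim v fun _ => w) ↔
      Alt (fun a b => θ.Realize ![a, b]) (fun y => ψ.Realize fun _ => y)
        (fun y => φ.Realize (Sum.elim v fun _ => y)) n w := by
  induction n generalizing w with
  | zero => simp [altFormula, Alt]
  | succ n ih =>
    simp only [altFormula, Alt, Formula.realize_iExs, realize_altStep, ih]
    exact ⟨fun ⟨i, h⟩ => ⟨i 0, h⟩, fun ⟨y, h⟩ => ⟨fun _ => y, h⟩⟩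

theorem definable₁_realize {α : Type x} (φ : L.Formula (α ⊕ Fin 1)) (v : α → M) :
    (Set.univ : Set M).Definable₁ L {y | φ.Realize (Sum.elim v fun _ => y)} := by
  rw [Set.Definable₁, Set.definable_iff_exists_formula_sum]
  refine ⟨φ.relabel (Sum.map (fun i => ⟨v i, trivial⟩) id), ?_⟩
  ext y
  rw [Set.mem_ofPred_eq, Set.mem_ofPred_eq, Set.mem_ofPred_eq, Formula.realize_relabel]
  congr! 1
  funext k
  rcases k with k | k
  · rfl
  · rw [Subsingleton.elim k 0]
    rfl

theorem exists_formula_of_definable₁ {D : Set M} (hD : (Set.univ : Set M).Definable₁ L D) :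
    ∃ (A : Finset M) (φ : L.Formula (A ⊕ Fin 1)),
      D = {y | φ.Realize (Sum.elim (fun a : A => (a : M)) fun _ => y)} := by
  obtain ⟨A, -, hA⟩ := Set.definable_iff_finitely_definable.1 hD
  obtain ⟨φ, hφ⟩ := Set.definable_iff_exists_formula_sum.1 hA
  refine ⟨A, φ, ?_⟩
  ext y
  exact Set.ext_iff.1 hφ fun _ => y

theorem definable₁_empty_realize (ψ : L.Formula (Fin 1)) :
    (∅ : Set M).Definable₁ L {y | ψ.Realize fun _ => y} := by
  refine Set.empty_definable_iff.2 ⟨ψ, ?_⟩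
  ext y
  rw [Set.mem_ofPred_eq, Set.mem_ofPred_eq, Set.mem_ofPred_eq]
  congr! 1
  funext k
  rw [Subsingleton.elim k 0]

theorem exists_formula_of_definable₁_empty {D : Set M} (hD : (∅ : Set M).Definable₁ L D) :
    ∃ ψ : L.Formula (Fin 1), ∀ y, y ∈ D ↔ ψ.Realize fun _ => y := by
  obtain ⟨ψ, hψ⟩ := Set.empty_definable_iff.1 hD
  exact ⟨ψ, fun y => Set.ext_iff.1 hψ fun _ => y⟩

theorem exists_formula_of_definable₂_empty {R : Set (M × M)}
    (hR : (∅ : Set M).Definable₂ L R) :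
    ∃ θ : L.Formula (Fin 2), ∀ a b, (a, b) ∈ R ↔ θ.Realize ![a, b] := by
  obtain ⟨θ, hθ⟩ := Set.empty_definable_iff.1 hR
  exact ⟨θ, fun a b => Set.ext_iff.1 hθ ![a, b]⟩

theorem definable₂_empty_realize (θ : L.Formula (Fin 2)) :
    (∅ : Set M).Definable₂ L {q | θ.Realize ![q.1, q.2]} := by
  refine Set.empty_definable_iff.2 ⟨θ, ?_⟩
  ext y
  rw [Set.mem_ofPred_eq, Set.mem_ofPred_eq, Set.mem_ofPred_eq]
  congr! 1
  funext k
  fin_cases k <;> rfl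

end Formulas

/-! ### From loci to formulas -/

section Saturated

variable {L : FirstOrder.Language.{u, v}} {T : L.Theory} {M : Type w} [L.Structure M] [M ⊨ T]
  [Nonempty M]

theorem mem_locus_iff {p : T.CompleteType (Fin 1)} {c a : M} (hc : c ∈ locus p M) :
    a ∈ locus p M ↔ ∀ ψ : L.Formula (Fin 1), ψ.Realize (fun _ => c) → ψ.Realize fun _ => a := by
  rw [← typeOf_eq_typeOf_iff (T := T), show T.typeOf (fun _ : Fin 1 => c) = p from hc]
  rfl

/-- The order axioms are universal in three variables. Were they to fail on every formula of the
type, saturation would produce a failing triple inside the locus. -/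
theorem exists_isOrderOn_of_isWeaklyOMinimalType (hM : IsSaturated L M Cardinal.aleph0)
    {p : T.CompleteType (Fin 1)} (hp : IsWeaklyOMinimalType p M) {c : M} (hc : c ∈ locus p M) :
    ∃ (ψ : L.Formula (Fin 1)) (θ : L.Formula (Fin 2)), ψ.Realize (fun _ => c) ∧
      IsOrderOn (fun a b : M => θ.Realize ![a, b]) {a | ψ.Realize fun _ => a} := by
  obtain ⟨lt, ⟨R, hR, hlt⟩, hord, -⟩ := hp
  obtain ⟨θ, hθ⟩ := exists_formula_of_definable₂_empty hR
  have hP : IsOrderOn (fun a b : M => θ.Realize ![a, b]) (locus p M) :=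
    isOrderOn_of_isStrictTotalOrder fun x y => (hlt x y).trans (hθ x y)
  by_contra! hcon
  let F : L.Formula (Fin 1) → L.Formula (Empty ⊕ Fin 3) := fun ψ =>
    (Formula.iInf fun i : Fin 3 => ψ.relabel fun _ => .inr i) ⊓
      (notOrderFormula θ).relabel .inr
  have hF : ∀ ψ (w : Fin 3 → M), (F ψ).Realize (Sum.elim Empty.elim w) ↔
      (∀ i, ψ.Realize fun _ => w i) ∧ (notOrderFormula θ).Realize w := by
    intro ψ w
    simp only [F, Formula.realize_inf, Formula.realize_iInf, Formula.realize_relabel,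
      Sum.elim_comp_inr]
    rfl
  obtain ⟨w, hw⟩ := hM.exists_realize_of_directed Empty.elim c F
    (fun ψ ψ' w h hw => (hF _ _).2 ⟨fun i => h _ (((hF _ _).1 hw).1 i), ((hF _ _).1 hw).2⟩) (by
      intro ψ hψ
      have := hcon ψ θ hψ
      rw [isOrderOn_iff] at this
      push Not at this
      obtain ⟨w, hw, hw'⟩ := this
      exact ⟨w, (hF ψ w).2 ⟨hw, hw'⟩⟩)
  refine (isOrderOn_iff θ _).1 hP w (fun i => (mem_locus_iff hc).2 fun ψ hψ => ?_)
    ((hF ⊤ w).1 (hw ⊤ (by simp))).2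
  exact ((hF ψ w).1 (hw ψ hψ)).1 i

omit [Nonempty M] in
theorem exists_isOrderOn_union (ψ : L.Formula (Fin 1)) (θ₁ θ₂ : L.Formula (Fin 2)) {Y : Set M}
    (h₁ : IsOrderOn (fun a b : M => θ₁.Realize ![a, b]) {a | ψ.Realize fun _ => a})
    (h₂ : IsOrderOn (fun a b : M => θ₂.Realize ![a, b]) Y) :
    ∃ θ : L.Formula (Fin 2),
      IsOrderOn (fun a b : M => θ.Realize ![a, b]) ({a | ψ.Realize fun _ => a} ∪ Y) := by
  let ψ' : Fin 2 → L.Formula (Fin 2) := fun i => ψ.relabel fun _ => i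
  refine ⟨(ψ' 0 ⊓ ψ' 1 ⊓ θ₁) ⊔ ((ψ' 0 ⊓ Formula.not (ψ' 1)) ⊔
    (Formula.not (ψ' 0) ⊓ Formula.not (ψ' 1) ⊓ θ₂)), ?_⟩
  have h0 : ∀ a b : M, (ψ' 0).Realize ![a, b] ↔ ψ.Realize fun _ => a := fun a b => by
    rw [Formula.realize_relabel]
    rfl
  have h1 : ∀ a b : M, (ψ' 1).Realize ![a, b] ↔ ψ.Realize fun _ => b := fun a b => by
    rw [Formula.realize_relabel]
    rfl
  simp only [Formula.realize_sup, Formula.realize_inf, Formula.realize_not, h0, h1, and_assoc]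
  exact h₁.union h₂

theorem exists_isOrderOn_univ (hM : IsSaturated L M Cardinal.aleph0)
    (h : ∀ p : T.CompleteType (Fin 1), IsWeaklyOMinimalType p M) :
    ∃ θ : L.Formula (Fin 2), IsOrderOn (fun a b : M => θ.Realize ![a, b]) Set.univ := by
  obtain ⟨G, hG, hfin, hcov⟩ := hM.exists_finite_cover
    {ψ | ∃ θ : L.Formula (Fin 2),
      IsOrderOn (fun a b : M => θ.Realize ![a, b]) {a | ψ.Realize fun _ => a}} (by
    intro c
    obtain ⟨ψ, θ, hψ, hθ⟩ := exists_isOrderOn_of_isWeaklyOMinimalType hM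
      (h (T.typeOf fun _ : Fin 1 => c)) (c := c) rfl
    exact ⟨ψ, ⟨θ, hθ⟩, hψ⟩)
  have key : ∃ θ : L.Formula (Fin 2), IsOrderOn (fun a b : M => θ.Realize ![a, b])
      {a | ∃ ψ ∈ G, ψ.Realize fun _ => a} := by
    clear hcov
    induction G, hfin using Set.Finite.induction_on with
    | empty => exact ⟨⊥, fun x ⟨_, h, _⟩ => h.elim⟩
    | insert _ _ ih =>
      rename_i ψ G _ _
      obtain ⟨θ₁, h₁⟩ := hG (Set.mem_insert ψ G)
      obtain ⟨θ₂, h₂⟩ := ih fun χ hχ => hG (Set.mem_insert_of_mem ψ hχ)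
      convert exists_isOrderOn_union ψ θ₁ θ₂ h₁ h₂ using 4
      ext a
      simp
  obtain ⟨θ, hθ⟩ := key
  exact ⟨θ, fun x _ y _ z _ => hθ x (hcov x) y (hcov y) z (hcov z)⟩

/-- Weak o-minimality of a type does not depend on the order. -/
theorem finConv_of_isWeaklyOMinimalType (hM : IsSaturated L M Cardinal.aleph0)
    {p : T.CompleteType (Fin 1)} (hp : IsWeaklyOMinimalType p M) (θ : L.Formula (Fin 2))
    [IsStrictTotalOrder (locus p M) fun a b => θ.Realize ![(a : M), b] ]
    {D : Set (locus p M)} (hD : IsRelDefinable L (locus p M) D) :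
    FinConv (fun a b : locus p M => θ.Realize ![(a : M), b]) D := by
  obtain ⟨lt, ⟨R, hR, hlt⟩, hord, hfin⟩ := hp
  obtain ⟨θ', hθ'⟩ := exists_formula_of_definable₂_empty hR
  obtain rfl : lt = fun a b : locus p M => θ'.Realize ![(a : M), b] := by
    funext a b
    exact propext ((hlt a b).trans (hθ' a b))
  have hfc : ∀ X, IsRelDefinable L (locus p M) X → FinConv _ X := fun X hX =>
    finite_isConvexComponent_iff.1 (hfin X hX)
  -- The rays of the new order are relatively definable, hence finite unions of convex sets for the
  -- old one.
  refine FinConv.of_invariant (isBackAndForth_partialElementary hM p)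
    (isInvariant_realize _ θ') (isInvariant_realize _ θ) (fun z => hfc _ ?_) (fun z => hfc _ ?_)
    (hfc D hD)
  · refine ⟨_, definable₁_realize (θ.relabel ![.inr 0, .inl 0]) fun _ : Fin 1 => (z : M), ?_⟩
    ext y
    exact (realize_relabel_pair θ (.inr 0) (.inl 0)
      (Sum.elim (fun _ : Fin 1 => (z : M)) fun _ : Fin 1 => (y : M))).symm
  · refine ⟨_, definable₁_realize (θ.relabel ![.inl 0, .inr 0]) fun _ : Fin 1 => (z : M), ?_⟩
    ext y
    exact (realize_relabel_pair θ (.inl 0) (.inr 0)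
      (Sum.elim (fun _ : Fin 1 => (z : M)) fun _ : Fin 1 => (y : M))).symm

omit [M ⊨ T] [Nonempty M] [L.Structure M] in
theorem not_alt_of_subtype {P : Set M} {lt : M → M → Prop} {D : M → Prop} {N : ℕ}
    (h : ∀ w : P, ¬ Alt (fun a b : P => lt a b) (fun _ => True) (fun y => D y) N w) (w : M) :
    ¬ Alt lt (· ∈ P) D (N + 1) w := by
  have key : ∀ n (w : P), Alt lt (· ∈ P) D n w →
      Alt (fun a b : P => lt a b) (fun _ => True) (fun y => D y) n w := by
    intro n
    induction n with
    | zero => exact fun _ _ => trivial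
    | succ n ih =>
      rintro w ⟨y, hyw, hy, hD, halt⟩
      exact ⟨⟨y, hy⟩, hyw, trivial, hD, ih ⟨y, hy⟩ halt⟩
  -- The base point w may lie outside P; the extra link supplies a base point in P.
  rintro ⟨y, -, hy, -, halt⟩
  exact h ⟨y, hy⟩ (key N ⟨y, hy⟩ halt)

/-- A bound on alternations in the locus of a type is a bound on a neighbourhood of the type. -/
theorem exists_formula_not_alt (hM : IsSaturated L M Cardinal.aleph0) {α : Type x} [Finite α]
    (v : α → M) (θ : L.Formula (Fin 2)) (φ : L.Formula (α ⊕ Fin 1))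
    {p : T.CompleteType (Fin 1)} {c : M} (hc : c ∈ locus p M) {N : ℕ}
    (h : ∀ w : M, ¬ Alt (fun a b => θ.Realize ![a, b]) (· ∈ locus p M)
      (fun y => φ.Realize (Sum.elim v fun _ => y)) N w) :
    ∃ ψ : L.Formula (Fin 1), ψ.Realize (fun _ => c) ∧
      ∀ w : M, ¬ Alt (fun a b => θ.Realize ![a, b]) (fun y => ψ.Realize fun _ => y)
        (fun y => φ.Realize (Sum.elim v fun _ => y)) N w := by
  have hmono : ∀ (n : ℕ) (ψ ψ' : L.Formula (Fin 1)) (w : M),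
      (∀ a : M, ψ.Realize (fun _ => a) → ψ'.Realize (fun _ => a)) →
      (altFormula θ ψ φ n).Realize (Sum.elim v fun _ => w) →
      (altFormula θ ψ' φ n).Realize (Sum.elim v fun _ => w) := by
    intro n ψ ψ' w hψ h
    rw [realize_altFormula] at h ⊢
    exact h.mono hψ fun _ _ => Iff.rfl
  -- If chains exist inside every formula of the type, saturation chooses the next point in all
  -- these formulas at once, hence in the locus, and keeps the remaining chains available.
  have key : ∀ n (w : M), (∀ ψ : L.Formula (Fin 1), ψ.Realize (fun _ => c) →
        (altFormula θ ψ φ n).Realize (Sum.elim v fun _ => w)) →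
      Alt (fun a b => θ.Realize ![a, b]) (· ∈ locus p M)
        (fun y => φ.Realize (Sum.elim v fun _ => y)) n w := by
    intro n
    induction n with
    | zero => exact fun _ _ => trivial
    | succ n ih =>
      intro w hw
      obtain ⟨y, hy⟩ := hM.exists_realize_of_directed (Sum.elim v fun _ : Fin 1 => w) c
        (fun ψ => altStep θ ψ φ (altFormula θ ψ φ n) n)
        (by
          intro ψ ψ' y hψ hy
          rw [realize_altStep] at hy ⊢
          exact ⟨hy.1, hψ _ hy.2.1, hy.2.2.1, hmono n ψ ψ' _ hψ hy.2.2.2⟩)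
        (fun ψ hψ => Formula.realize_iExs.1 (hw ψ hψ))
      have hy' := fun ψ hψ => (realize_altStep _ _ _ _ _ _ _ _).1 (hy ψ hψ)
      have htop := hy' ⊤ (by simp)
      exact ⟨y 0, htop.1, (mem_locus_iff hc).2 fun ψ hψ => (hy' ψ hψ).2.1, htop.2.2.1,
        ih (y 0) fun ψ hψ => (hy' ψ hψ).2.2.2⟩
  by_contra! hcon
  obtain ⟨w, hw⟩ := hM.exists_realize_of_directed v c (fun ψ => altFormula θ ψ φ N)
    (by
      intro ψ ψ' w hψ hw
      obtain ⟨a, rfl⟩ : ∃ a, w = fun _ => a := ⟨w 0, funext fun k => by rw [Subsingleton.elim k 0]⟩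
      exact hmono N ψ ψ' a hψ hw)
    (by
      intro ψ hψ
      obtain ⟨w, hw⟩ := hcon ψ hψ
      exact ⟨fun _ => w, (realize_altFormula _ _ _ _ _ _).2 hw⟩)
  obtain ⟨a, rfl⟩ : ∃ a, w = fun _ => a := ⟨w 0, funext fun k => by rw [Subsingleton.elim k 0]⟩
  exact h a (key N a hw)

end Saturated

/-! ### Transfer between models and the two implications -/

section Transfer

variable {L : FirstOrder.Language.{u, v}} {T : L.Theory} {M : Type w} [L.Structure M] [M ⊨ T]
  [Nonempty M] {N : Type y} [L.Structure N] [N ⊨ T] [Nonempty N]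

theorem exists_realize_iff (hT : T.IsComplete) {α : Type x} [Finite α] (φ : L.Formula α) :
    (∃ v : α → M, φ.Realize v) ↔ ∃ v : α → N, φ.Realize v := by
  let σ : L.Sentence := Formula.iExs α (φ.relabel (Sum.inr : α → Empty ⊕ α))
  have hM : M ⊨ σ ↔ ∃ v : α → M, φ.Realize v := by
    simp only [σ, Sentence.Realize, Formula.realize_iExs, Formula.realize_relabel,
      Sum.elim_comp_inr]
  have hN : N ⊨ σ ↔ ∃ v : α → N, φ.Realize v := by
    simp only [σ, Sentence.Realize, Formula.realize_iExs, Formula.realize_relabel,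
      Sum.elim_comp_inr]
  rw [← hM, ← hN, hT.realize_sentence_iff, hT.realize_sentence_iff]

theorem IsSaturated.exists_realize_same (hM : IsSaturated L M Cardinal.aleph0)
    (hT : T.IsComplete) {α : Type x} [Finite α] (b : α → N) :
    ∃ a : α → M, ∀ φ : L.Formula α, φ.Realize a ↔ φ.Realize b := by
  have hr : ∀ (φ : L.Formula α) (a : α → M),
      (φ.relabel (Sum.inr : α → Empty ⊕ α)).Realize (Sum.elim Empty.elim a) ↔ φ.Realize a := by
    intro φ a
    rw [Formula.realize_relabel, Sum.elim_comp_inr]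
  obtain ⟨a, ha⟩ := hM.exists_realize α (Empty.elim : Empty → M)
    ((fun φ => φ.relabel Sum.inr) '' {φ : L.Formula α | φ.Realize b}) (by
    intro Δ hΔ hfin
    have : Finite Δ := hfin
    replace hΔ : ∀ φ ∈ Δ, _ := fun φ hφ => hΔ hφ
    choose! g hg hg' using hΔ
    obtain ⟨a, ha⟩ := (exists_realize_iff (M := M) (N := N) hT (Formula.iInf fun φ : Δ => g φ)).2
      ⟨b, Formula.realize_iInf.2 fun φ => hg φ φ.2⟩
    refine ⟨a, fun φ hφ => ?_⟩
    rw [← hg' φ hφ]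
    exact (hr _ _).2 (Formula.realize_iInf.1 ha ⟨φ, hφ⟩))
  have ha' : ∀ φ : L.Formula α, φ.Realize b → φ.Realize a := fun φ hφ =>
    (hr φ a).1 (ha _ ⟨φ, hφ, rfl⟩)
  refine ⟨a, fun φ => ⟨fun h => ?_, ha' φ⟩⟩
  by_contra hcon
  exact Formula.realize_not.1 (ha' (Formula.not φ) (Formula.realize_not.2 hcon)) h

theorem IsOrderOn.transfer (hT : T.IsComplete) {θ : L.Formula (Fin 2)}
    (h : IsOrderOn (fun a b : M => θ.Realize ![a, b]) Set.univ) :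
    IsOrderOn (fun a b : N => θ.Realize ![a, b]) Set.univ := by
  rw [isOrderOn_iff] at h ⊢
  intro v _ hv
  obtain ⟨w, hw⟩ := (exists_realize_iff (M := M) hT (notOrderFormula θ)).2 ⟨v, hv⟩
  exact h w (fun _ => trivial) hw

theorem exists_finite_cover_not_alt (hM : IsSaturated L M Cardinal.aleph0)
    (h : ∀ p : T.CompleteType (Fin 1), IsWeaklyOMinimalType p M) {θ : L.Formula (Fin 2)}
    (hθ : IsOrderOn (fun a b : M => θ.Realize ![a, b]) Set.univ) {α : Type x} [Finite α]
    (v : α → M) (φ : L.Formula (α ⊕ Fin 1)) :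
    ∃ G : Set (L.Formula (Fin 1)), G.Finite ∧ (∀ c : M, ∃ ψ ∈ G, ψ.Realize fun _ => c) ∧
      ∀ ψ ∈ G, ∃ n, ∀ w : M, ¬ (altFormula θ ψ φ n).Realize (Sum.elim v fun _ => w) := by
  obtain ⟨G, hG, hfin, hcov⟩ := hM.exists_finite_cover
    {ψ | ∃ n, ∀ w : M, ¬ (altFormula θ ψ φ n).Realize (Sum.elim v fun _ => w)} (by
    intro c
    let p := T.typeOf fun _ : Fin 1 => c
    have hST : IsStrictTotalOrder (locus p M) fun a b => θ.Realize ![(a : M), b] :=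
      IsOrderOn.isStrictTotalOrder fun x _ y _ z _ => by
        have := hθ x trivial y trivial z trivial
        rwa [Subtype.ext_iff]
    obtain ⟨n, hn⟩ := (finConv_of_isWeaklyOMinimalType hM (h p) θ
      ⟨_, definable₁_realize φ v, rfl⟩).exists_not_alt fun _ => True
    obtain ⟨ψ, hψc, hψ⟩ := exists_formula_not_alt hM v θ φ (p := p) (c := c) rfl
      (not_alt_of_subtype hn)
    exact ⟨ψ, ⟨_, fun w hw => hψ w ((realize_altFormula _ _ _ _ _ _).1 hw)⟩, hψc⟩)
  exact ⟨G, hfin, hcov, hG⟩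

/-- If all types are weakly o-minimal, definable sets in all models are Boolean combinations of
`∅`-definable and convex sets. -/
theorem isWeaklyQuasiOMinimalStructure_of_forall (hT : T.IsComplete)
    (hM : IsSaturated L M Cardinal.aleph0)
    (h : ∀ p : T.CompleteType (Fin 1), IsWeaklyOMinimalType p M) {θ : L.Formula (Fin 2)}
    (hθ : IsOrderOn (fun a b : M => θ.Realize ![a, b]) Set.univ) :
    IsWeaklyQuasiOMinimalStructure L N fun a b => θ.Realize ![a, b] := by
  have hST := (hθ.transfer (N := N) hT).isStrictTotalOrder
  refine ⟨hST, fun D hD => ?_⟩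
  obtain ⟨A, φ, rfl⟩ := exists_formula_of_definable₁ hD
  -- The finitely many parameters are replaced by a tuple of the same type in M, so N itself need
  -- not be saturated.
  obtain ⟨a, ha⟩ := hM.exists_realize_same (N := N) hT fun i : A => (i : N)
  obtain ⟨G, hfin, hcov, hG⟩ := exists_finite_cover_not_alt hM h hθ a φ
  let 𝒜 := BooleanSubalgebra.closure
    {X : Set N | (∅ : Set N).Definable₁ L X ∨ IsConvexIn (fun a b => θ.Realize ![a, b]) X}
  have hsU : ∀ 𝒞 : Set (Set N), 𝒞.Finite → (∀ C ∈ 𝒞, C ∈ 𝒜) → ⋃₀ 𝒞 ∈ 𝒜 := by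
    intro 𝒞 hf
    induction 𝒞, hf using Set.Finite.induction_on with
    | empty =>
      intro _
      rw [Set.sUnion_empty]
      exact BooleanSubalgebra.bot_mem
    | insert _ _ ih =>
      intro hC
      rw [Set.sUnion_insert]
      exact BooleanSubalgebra.sup_mem (hC _ (Set.mem_insert _ _))
        (ih fun C h => hC C (Set.mem_insert_of_mem _ h))
  have hcovN : ∀ c : N, ∃ ψ ∈ G, ψ.Realize fun _ => c := by
    intro c
    by_contra! hcon
    have : Finite G := hfin
    obtain ⟨d, hd⟩ := (exists_realize_iff (M := M) hT
      (Formula.iInf fun ψ : G => Formula.not (ψ : L.Formula (Fin 1)))).2 ⟨fun _ => c,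
        Formula.realize_iInf.2 fun ψ => Formula.realize_not.2 (hcon ψ ψ.2)⟩
    obtain ⟨ψ, hψ, hψd⟩ := hcov (d 0)
    refine Formula.realize_not.1 (Formula.realize_iInf.1 hd ⟨ψ, hψ⟩) ?_
    convert hψd using 2 with k
    rw [Subsingleton.elim k 0]
  set D := {y : N | φ.Realize (Sum.elim (fun i : A => (i : N)) fun _ => y)}
  have hDG : D = ⋃₀ ((fun ψ : L.Formula (Fin 1) => {y : N | ψ.Realize fun _ => y} ∩ D) '' G) := by
    ext y
    simp only [Set.sUnion_image, Set.mem_iUnion, Set.mem_inter_iff, Set.mem_ofPred_eq]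
    constructor
    · intro hy
      obtain ⟨ψ, hψ, hψy⟩ := hcovN y
      exact ⟨ψ, hψ, hψy, hy⟩
    · rintro ⟨ψ, hψ, hψy, hy⟩
      exact hy
  rw [hDG]
  refine hsU _ (hfin.image _) ?_
  rintro _ ⟨ψ, hψ, rfl⟩
  obtain ⟨n, hn⟩ := hG ψ hψ
  have hnN : ∀ w : N, ¬ Alt (fun a b => θ.Realize ![a, b])
      (· ∈ {y : N | ψ.Realize fun _ => y}) (· ∈ D) n w := by
    intro w hw
    have hw' := (realize_altFormula θ ψ φ (fun i : A => (i : N)) n w).2 hw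
    obtain ⟨d, hd⟩ := Formula.realize_iExs.1
      ((ha ((altFormula θ ψ φ n).iExs (Fin 1))).2 (Formula.realize_iExs.2 ⟨_, hw'⟩))
    refine hn (d 0) ?_
    convert hd using 3 with k
    rw [Subsingleton.elim k 0]
  obtain ⟨F, ⟨𝒞, hf, hc, rfl⟩, hF⟩ := exists_finConv_of_not_alt hnN
  simp only [hF]
  exact BooleanSubalgebra.inf_mem
    (BooleanSubalgebra.subset_closure (.inl (definable₁_empty_realize ψ)))
    (hsU 𝒞 hf fun C hC => BooleanSubalgebra.subset_closure (.inr (hc C hC)))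

theorem isWeaklyOMinimalType_of_isWeaklyQuasiOMinimalStructure {θ : L.Formula (Fin 2)}
    (h : IsWeaklyQuasiOMinimalStructure L M fun a b => θ.Realize ![a, b])
    (p : T.CompleteType (Fin 1)) : IsWeaklyOMinimalType p M := by
  obtain ⟨hord, hD⟩ := h
  have hST : IsStrictTotalOrder (locus p M) fun a b => θ.Realize ![(a : M), b] :=
    { trichotomous := fun a b hab hba => Subtype.ext (hord.trichotomous _ _ hab hba)
      irrefl := fun a => hord.irrefl a
      trans := fun a b c => hord.trans a b c }
  refine ⟨fun a b => θ.Realize ![(a : M), b],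
    ⟨_, definable₂_empty_realize θ, fun x y => Iff.rfl⟩, hST, ?_⟩
  rintro _ ⟨D, hDef, rfl⟩
  rw [finite_isConvexComponent_iff]
  -- Taking traces on the locus is a homomorphism of Boolean algebras, so only the generators need
  -- checking; the locus lies inside or outside each ∅-definable set.
  have hcomap : D ∈ (finConvSubalgebra (locus p M)
      fun a b => θ.Realize ![(a : M), b]).comap
        (BoundedLatticeHom.mk (LatticeHom.mk (SupHom.mk (Set.preimage Subtype.val)
          fun _ _ => rfl) fun _ _ => rfl) rfl rfl) := by
    refine BooleanSubalgebra.closure_le.2 ?_ (hD D hDef)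
    rintro X (hX | hX)
    · obtain ⟨ψ, hψ⟩ := exists_formula_of_definable₁_empty hX
      refine IsConvexIn.finConv fun a ha b _ c _ _ => ?_
      exact (hψ c).2 ((realize_iff_of_mem_locus c.2 a.2 ψ).2 ((hψ a).1 ha))
    · exact IsConvexIn.finConv fun a ha b hb c hac hcb => hX a ha b hb c hac hcb
  exact hcomap

end Transfer

end WeakOMin

theorem mainTheorem9 {L : FirstOrder.Language.{u, v}} (T : L.Theory) (hT : T.IsComplete)
    (𝕄 : Type (max u v w)) [L.Structure 𝕄] [𝕄 ⊨ T] [Infinite 𝕄]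
    (h𝕄 : WeakOMin.IsSaturated L 𝕄 Cardinal.aleph0) :
    WeakOMin.IsWeaklyQuasiOMinimal.{u, v, w} T ↔
      ∀ p : T.CompleteType (Fin 1), WeakOMin.IsWeaklyOMinimalType p 𝕄 := by
  constructor
  · rintro ⟨θ, hθ⟩ p
    exact WeakOMin.isWeaklyOMinimalType_of_isWeaklyQuasiOMinimalStructure (hθ 𝕄) p
  · intro h
    obtain ⟨θ, hθ⟩ := WeakOMin.exists_isOrderOn_univ h𝕄 h
    exact ⟨θ, fun N _ _ _ =>
      WeakOMin.isWeaklyQuasiOMinimalStructure_of_forall hT h𝕄 h hθ⟩
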